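/- Let $\mathcal{M}$ be a $\mathrm{II}_1$ factor with faithful normal tracial state $\tau$, let $\mathcal{A}$ be a maximal abelian self-adjoint subalgebra (MASA) of $\mathcal{M}$, and let $E_{\mathcal{A}} : \mathcal{M} \to \mathcal{A}$ be the normal conditional expectation onto $\mathcal{A}$. For a self-adjoint $S \in \mathcal{M}$ let $m_S$ be its spectral distribution, i.e. the Borel probability measure on $\mathbb{R}$ with $\int_{\mathbb{R}} x^n \, dm_S(x) = \tau(S^n)$ for all $n \geq 0$, and for an arbitrary $S \in \mathcal{M}$ define its singular value function by \[ \mu_s(S) = \inf\{ t \in \mathbb{R} \mid m_{|S|}((t,\infty)) \leq s \}, \qquad s \in [0,1), \qquad |S| = (S^*S)^{1/2}. \] For $S, T \in \mathcal{M}$ write $S \prec_w T$ if $\int_0^t \mu_s(S)\,ds \leq \int_0^t \mu_s(T)\,ds$ for all $t \in [0,1]$. Let $A \in \mathcal{A}$ and $T \in \mathcal{M}$ be positive elements such that $A \prec_w T$. If \[ \sup \{ \mu_s(A) \mid s \in [0,1) \} \leq \inf \{ \mu_s(T) \mid s \in [0,1) \}, \] then there are unitaries $U, V \in \mathcal{M}$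 such that $E_{\mathcal{A}}(UTV) = A$. -/

import Mathlib

open scoped ComplexOrder CompactlySupported

noncomputable section

/-! ### Von Neumann algebras as ordered C⋆-algebras -/

namespace VonNeumannAlgebra

variable {H : Type*} [NormedAddCommGroup H] [InnerProductSpace ℂ H] [CompleteSpace H]

instance instSMulMemClass : SMulMemClass (VonNeumannAlgebra H) ℂ (H →L[ℂ] H) where
  smul_mem {s} c _ hx := s.toStarSubalgebra.smul_mem hx c

theorem isClosed_coe (M : VonNeumannAlgebra H) : IsClosed (M : Set (H →L[ℂ] H)) := by
  rw [← M.centralizer_centralizer]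
  exact Set.isClosed_centralizer _

/-- A von Neumann algebra, with the operations and the norm of `H →L[ℂ] H`, is a C⋆-algebra. -/
instance instCStarAlgebra (M : VonNeumannAlgebra H) : CStarAlgebra M :=
  StarSubalgebra.cstarAlgebra M (h_closed := M.isClosed_coe)

/-- The order on `M` is the one of `H →L[ℂ] H`; its nonnegative elements are sums of
elements `star y * y` with `y ∈ M`. -/
instance instStarOrderedRing (M : VonNeumannAlgebra H) : StarOrderedRing M := by
  refine StarOrderedRing.of_nonneg_iff' (fun {x y} h z => ?_) (fun x => ⟨fun hx => ?_, ?_⟩)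
  · exact add_le_add_right (show (x : H →L[ℂ] H) ≤ y from h) (z : H →L[ℂ] H)
  · have hx' : (0 : H →L[ℂ] H) ≤ x := hx
    have hmem : CFC.sqrt (x : H →L[ℂ] H) ∈ M := by
      rw [← SetLike.mem_coe, ← M.centralizer_centralizer]
      intro y hy
      have hxy : Commute (x : H →L[ℂ] H) y := hy x x.2
      exact (hxy.cfcₙ_nnreal NNReal.sqrt).symm
    refine ⟨⟨CFC.sqrt (x : H →L[ℂ] H), hmem⟩, Subtype.ext ?_⟩
    change (x : H →L[ℂ] H) = star (CFC.sqrt (x : H →L[ℂ] H)) * CFC.sqrt (x : H →L[ℂ] H)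
    rw [(IsSelfAdjoint.of_nonneg (CFC.sqrt_nonneg _)).star_eq, CFC.sqrt_mul_sqrt_self _ hx']
  · rintro ⟨y, rfl⟩
    exact star_mul_self_nonneg (y : H →L[ℂ] H)

end VonNeumannAlgebra

/-! ### Spectral distributions and singular values -/

section Spectral

variable {M : Type*} [CStarAlgebra M] [PartialOrder M] [StarOrderedRing M]

/-- The functional `f ↦ τ (f(T))` on the real continuous functions on the spectrum of a
self-adjoint `T`. -/
def spectralFunctional (τ : M →ₚ[ℂ] ℂ) (T : M) (hT : IsSelfAdjoint T) :
    C_c(spectrum ℝ T, ℝ) →ₚ[ℝ] ℝ :=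
  PositiveLinearMap.mk₀
    { toFun := fun f => (τ (cfcHom hT f.toContinuousMap)).re
      map_add' := by
        intro f g
        have h : (f + g).toContinuousMap = f.toContinuousMap + g.toContinuousMap := rfl
        rw [h, map_add, map_add, Complex.add_re]
      map_smul' := by
        intro c f
        have h : (c • f).toContinuousMap = c • f.toContinuousMap := rfl
        rw [h, map_smul, ← Complex.coe_smul, map_smul]
        simp }
    (by
      intro f hf
      have h : 0 ≤ cfcHom hT f.toContinuousMap := by
        rw [cfcHom_nonneg_iff]
        exact hf
      exact (Complex.nonneg_iff.mp (τ.map_nonneg h)).1)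

/-- The spectral distribution of a self-adjoint `T` with respect to `τ`: the Borel measure `m_T`
on `ℝ`, carried by the spectrum, with `∫ f dm_T = τ (f(T))` for continuous `f`. -/
def spectralDistribution (τ : M →ₚ[ℂ] ℂ) (T : M) (hT : IsSelfAdjoint T) :
    MeasureTheory.Measure ℝ :=
  (RealRMK.rieszMeasure (spectralFunctional τ T hT)).map Subtype.val

/-- Integration against the spectral distribution is the functional calculus followed by `τ`. -/
theorem integral_spectralDistribution (τ : M →ₚ[ℂ] ℂ) (T : M) (hT : IsSelfAdjoint T)
    (f : ℝ → ℝ) (hf : Continuous f) :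
    ∫ x, f x ∂(spectralDistribution τ T hT) = (τ (cfc f T)).re := by
  rw [spectralDistribution, MeasureTheory.integral_map (by fun_prop)
    hf.measurable.aestronglyMeasurable]
  let g : C(spectrum ℝ T, ℝ) := ⟨fun x => f x, by fun_prop⟩
  let F : C_c(spectrum ℝ T, ℝ) := ⟨g, HasCompactSupport.of_compactSpace _⟩
  have h := RealRMK.integral_rieszMeasure (spectralFunctional τ T hT) F
  rw [cfc_apply f T hT hf.continuousOn]
  exact h

/-- The moments of the spectral distribution are `∫ x ^ n dm_T = τ (T ^ n)`. -/
theorem integral_pow_spectralDistribution (τ : M →ₚ[ℂ] ℂ) (T : M) (hT : IsSelfAdjoint T) (n : ℕ) :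
    ((∫ x, x ^ n ∂(spectralDistribution τ T hT) : ℝ) : ℂ) = τ (T ^ n) := by
  rw [integral_spectralDistribution τ T hT _ (by fun_prop), cfc_pow_id (R := ℝ) T n hT]
  have h : IsSelfAdjoint (τ (T ^ n)) := (hT.pow n).map τ
  exact Complex.conj_eq_iff_re.mp h

/-- The eigenvalue function `λ_s(T) = inf {t | m_T((t, ∞)) ≤ s}`, meaningful for `s ∈ [0, 1)`. -/
def eigenvalueFunction (τ : M →ₚ[ℂ] ℂ) (T : M) (hT : IsSelfAdjoint T) (s : ℝ) : ℝ :=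
  sInf {t : ℝ | spectralDistribution τ T hT (Set.Ioi t) ≤ ENNReal.ofReal s}

/-- The singular value function `μ_s(T) = λ_s(|T|)`, meaningful for `s ∈ [0, 1)`. -/
def singularValueFunction (τ : M →ₚ[ℂ] ℂ) (T : M) (s : ℝ) : ℝ :=
  eigenvalueFunction τ (CFC.abs T) (IsSelfAdjoint.of_nonneg (CFC.abs_nonneg T)) s

/-- `S ≺_w T`: absolute submajorization of `S` by `T`. -/
def Submajorizes (τ : M →ₚ[ℂ] ℂ) (T S : M) : Prop :=
  ∀ t ∈ Set.Icc (0 : ℝ) 1,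
    ∫ s in (0 : ℝ)..t, singularValueFunction τ S s ≤ ∫ s in (0 : ℝ)..t, singularValueFunction τ T s

end Spectral

/-! ### II₁ factors, traces, MASAs and conditional expectations -/

section Factors

variable {M : Type*} [CStarAlgebra M] [PartialOrder M] [StarOrderedRing M]

/-- A faithful normal tracial state. Positivity is part of the type of `τ`; normality is
preservation of suprema of increasing nets. -/
structure IsFaithfulNormalTrace (τ : M →ₚ[ℂ] ℂ) : Prop where
  map_one : τ 1 = 1
  tracial : ∀ x y : M, τ (x * y) = τ (y * x)
  faithful : ∀ x : M, τ (star x * x) = 0 → x = 0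
  normal : ScottContinuous τ

/-- A maximal abelian self-adjoint subalgebra. -/
def IsMASA (𝒜 : StarSubalgebra ℂ M) : Prop :=
  Maximal (fun B : StarSubalgebra ℂ M => ∀ x ∈ B, ∀ y ∈ B, x * y = y * x) 𝒜

/-- A normal conditional expectation of `M` onto a ⋆-subalgebra: a positive linear map onto the
subalgebra which fixes it, is a bimodule map over it, and preserves suprema of increasing nets. -/
structure IsNormalConditionalExpectation {𝒜 : StarSubalgebra ℂ M} (E : M →ₚ[ℂ] 𝒜) : Prop where
  map_coe : ∀ a : 𝒜, E (a : M) = a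
  bimodule : ∀ (a b : 𝒜) (x : M), E ((a : M) * x * (b : M)) = a * E x * b
  normal : ScottContinuous E

end Factors

/-- A factor of type II₁: the centre is trivial, the algebra is finite (every isometry is a
unitary), and there are no minimal projections. -/
structure VonNeumannAlgebra.IsTypeIIOneFactor {H : Type*} [NormedAddCommGroup H]
    [InnerProductSpace ℂ H] [CompleteSpace H] (M : VonNeumannAlgebra H) : Prop where
  nontrivial : Nontrivial M
  center_eq_bot : Subalgebra.center ℂ M = ⊥
  finite : ∀ v : M, star v * v = 1 → v * star v = 1
  no_minimal : ∀ p : M, IsStarProjection p → p ≠ 0 →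
    ∃ q : M, IsStarProjection q ∧ q ≠ 0 ∧ q ≠ p ∧ q ≤ p

end

/-! Let c be the supremum of the singular values of A. Faithfulness of the trace turns the
hypothesis on singular values into operator inequalities 0 ≤ A ≤ c ≤ T, and the rest of the argument
uses only these (`exists_unitaries_of_le`).

The problem is solved locally and then exhausted. A cell is a partial isometry u from a projection p
commuting with T onto a projection q of 𝒜, together with v from q onto p, such that E(uTv) = Aq.
Below any nonzero p commuting with T and any nonzero q in 𝒜 there is a cell (`exists_cell`). A
maximal orthogonal family of cells therefore fills the identity: otherwise the complementary
projections would contain one more cell. The sums U and V of the two families are unitaries because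
M is finite, and E(UTV) = A because E is an 𝒜-bimodule map and so can be checked on each q.

To build a cell, look at T - c on p and c - A on q. If both vanish, T and A are the same scalar c
there, and any partial isometry between subprojections of equal trace works with v = u*. Otherwise
there are spectral projections on which T is nearly a scalar t and A nearly a scalar l < t.
Projections of prescribed trace exist both in 𝒜 and in the commutant of T
(`exists_subprojection_trace_eq`), and projections of equal trace are equivalent, so T can be
transported to a corner q in 𝒜, where the problem becomes: X near tq, a near lq, find corner
unitaries with E(UXV) = a.

In such a corner, split into three equivalent pieces permuted by P, the unitary W = (l/t)q + βP +
γP* satisfies E(tW) = lq. Multiplying W on both sides by exponentials of skew-adjoint elements, the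
derivative of the expectation has an explicit right inverse when β² ≠ γ². A quantitative inverse
function argument then reaches every a near lq (`exists_exp_mul_exp_eq`). Its radius depends only on
l, t and the bound of E, so it can be fixed before the spectral projections are chosen. -/

noncomputable section

/-! ### Range projections and strong sums of partial isometries -/

namespace VonNeumannAlgebra

variable {H : Type*} [NormedAddCommGroup H] [InnerProductSpace ℂ H] [CompleteSpace H]
  {M : VonNeumannAlgebra H}

theorem mem_of_commute_commutant {x : H →L[ℂ] H} (h : ∀ y ∈ M.commutant, y * x = x * y) :
    x ∈ M := by
  rw [← M.commutant_commutant, mem_commutant_iff]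
  exact h

theorem isStarProjection_coe {p : M} : IsStarProjection (p : H →L[ℂ] H) ↔ IsStarProjection p := by
  constructor
  · rintro ⟨h1, h2⟩
    exact ⟨Subtype.ext h1, Subtype.ext h2⟩
  · rintro ⟨h1, h2⟩
    exact ⟨congrArg Subtype.val h1, congrArg Subtype.val h2⟩

/-- The closed linear span of the ranges of the operators in `s`. -/
def closedRange (s : Set M) : Submodule ℂ H :=
  (⨆ x : s, ((x : M) : H →L[ℂ] H).range).topologicalClosure

instance (s : Set M) : CompleteSpace (closedRange s) :=
  (Submodule.isClosed_topologicalClosure _).completeSpace_coe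

theorem apply_mem_closedRange {s : Set M} {x : M} (hx : x ∈ s) (ξ : H) :
    (x : H →L[ℂ] H) ξ ∈ closedRange s :=
  Submodule.le_topologicalClosure _
    (Submodule.mem_iSup_of_mem (⟨x, hx⟩ : s) (LinearMap.mem_range_self _ ξ))

theorem closedRange_le {s : Set M} {K : Submodule ℂ H} (hK : IsClosed (K : Set H))
    (h : ∀ x ∈ s, ∀ ξ, (x : H →L[ℂ] H) ξ ∈ K) : closedRange s ≤ K := by
  refine Submodule.topologicalClosure_minimal _ (iSup_le ?_) hK
  rintro ⟨x, hx⟩ _ ⟨ξ, rfl⟩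
  exact h x hx ξ

/-- An operator of the commutant commutes with each member of `s`, hence maps its range into itself;
a projection whose range is invariant under the commutant lies in `M`. -/
theorem starProjection_closedRange_mem (s : Set M) : (closedRange s).starProjection ∈ M := by
  rw [IsStarProjection.mem_iff isStarProjection_starProjection]
  intro y hy
  rw [Submodule.range_starProjection, Module.End.mem_invtSubmodule]
  refine closedRange_le (K := (closedRange s).comap (y : H →ₗ[ℂ] H)) ?_ ?_
  · exact (Submodule.isClosed_topologicalClosure _).preimage y.continuous
  · intro x hx ξ
    have h : (x : H →L[ℂ] H) * y = y * x := mem_commutant_iff.mp hy x x.2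
    have h2 : y ((x : H →L[ℂ] H) ξ) = (x : H →L[ℂ] H) (y ξ) :=
      (congrArg (fun z : H →L[ℂ] H => z ξ) h).symm
    change y ((x : H →L[ℂ] H) ξ) ∈ closedRange s
    rw [h2]
    exact apply_mem_closedRange hx _

/-- The projection onto the closed linear span of the ranges of the operators in `s`. -/
def supProj (s : Set M) : M := ⟨(closedRange s).starProjection, starProjection_closedRange_mem s⟩

theorem isStarProjection_supProj (s : Set M) : IsStarProjection (supProj s) :=
  isStarProjection_coe.mp isStarProjection_starProjection

theorem supProj_mul {s : Set M} {x : M} (hx : x ∈ s) : supProj s * x = x := by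
  refine Subtype.ext (ContinuousLinearMap.ext fun ξ => ?_)
  exact Submodule.starProjection_eq_self_iff.mpr (apply_mem_closedRange hx ξ)

theorem mul_supProj_eq_zero {s : Set M} {z : M} (hz : ∀ x ∈ s, z * x = 0) : z * supProj s = 0 := by
  refine Subtype.ext (ContinuousLinearMap.ext fun ξ => ?_)
  have h : closedRange s ≤ (z : H →L[ℂ] H).ker := by
    refine closedRange_le (z : H →L[ℂ] H).isClosed_ker fun x hx ξ => ?_
    exact congrArg (fun w : M => (w : H →L[ℂ] H) ξ) (hz x hx)
  exact h (Submodule.starProjection_apply_mem _ ξ)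

theorem supProj_mul_eq {s : Set M} {p : M} (hp : ∀ x ∈ s, p * x = x) :
    p * supProj s = supProj s := by
  have := mul_supProj_eq_zero (s := s) (z := p - 1) fun x hx => by rw [sub_mul, hp x hx]; simp
  rwa [sub_mul, one_mul, sub_eq_zero] at this

/-- The hypotheses say that `y` and `star y` both leave the closed range invariant, so the range
reduces `y`. -/
theorem commute_supProj {s : Set M} {y : M} (h : ∀ x ∈ s, supProj s * (y * x) = y * x)
    (h' : ∀ x ∈ s, supProj s * (star y * x) = star y * x) : Commute y (supProj s) := by
  have key : ∀ w : M, (∀ x ∈ s, supProj s * (w * x) = w * x) →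
      supProj s * w * supProj s = w * supProj s := fun w hw => by
    have := mul_supProj_eq_zero (s := s) (z := (supProj s - 1) * w) fun x hx => by
      rw [mul_assoc, sub_mul, hw x hx, one_mul, sub_self]
    rwa [sub_mul, one_mul, sub_mul, sub_eq_zero] at this
  have h1 := key y h
  have h2 := congrArg star (key (star y) h')
  simp only [star_mul, star_star, (isStarProjection_supProj s).isSelfAdjoint.star_eq] at h2
  rw [commute_iff_eq, ← h1, mul_assoc, h2]


/-- The supremum is taken among all elements of `M`, as normality of the trace requires. The
projections of the chain converge strongly to `supProj s`, so inequalities between quadratic forms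
pass to the limit. -/
theorem isLUB_supProj {s : Set M} (hs : ∀ p ∈ s, IsStarProjection p) (hc : IsChain (· ≤ ·) s)
    (hne : s.Nonempty) : IsLUB s (supProj s) := by
  constructor
  · intro p hp
    rw [(hs p hp).le_iff_mul_eq_right (isStarProjection_supProj s)]
    exact supProj_mul hp
  · intro x hx
    have : Nonempty s := hne.to_subtype
    have : IsDirectedOrder s := ⟨fun a b => by
      rcases hc.total a.2 b.2 with h | h
      · exact ⟨b, h, le_rfl⟩
      · exact ⟨a, le_rfl, h⟩⟩
    let U : s → Submodule ℂ H := fun p => ((p : M) : H →L[ℂ] H).range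
    have hp : ∀ p : s, ∃ (_ : (U p).HasOrthogonalProjection),
        ((p : M) : H →L[ℂ] H) = (U p).starProjection := fun p =>
      isStarProjection_iff_eq_starProjection_range.mp
        (isStarProjection_coe.mpr (hs p p.2))
    choose i hi using hp
    have hU : Monotone U := by
      rintro a b hab _ ⟨ξ, rfl⟩
      have h : (b : M) * (a : M) = a :=
        ((hs a a.2).le_iff_mul_eq_right (hs b b.2)).mp hab
      exact ⟨((a : M) : H →L[ℂ] H) ξ, congrArg (fun w : M => (w : H →L[ℂ] H) ξ) h⟩
    have hx' : ∀ p ∈ s, (p : H →L[ℂ] H) ≤ (x : H →L[ℂ] H) := fun p hp => hx hp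
    change ((supProj s : M) : H →L[ℂ] H) ≤ (x : H →L[ℂ] H)
    have hsa : IsSelfAdjoint (x : H →L[ℂ] H) := by
      obtain ⟨p, hp⟩ := hne
      have h0 : (0 : H →L[ℂ] H) ≤ (p : H →L[ℂ] H) := (isStarProjection_coe.mpr (hs p hp)).nonneg
      exact IsSelfAdjoint.of_nonneg (h0.trans (hx' p hp))
    rw [ContinuousLinearMap.le_def, ContinuousLinearMap.isPositive_def']
    refine ⟨hsa.sub (isStarProjection_coe.mpr (isStarProjection_supProj s)).isSelfAdjoint,
      fun ξ => ?_⟩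
    have ht := Submodule.starProjection_tendsto_closure_iSup U hU ξ
    have ht2 : Filter.Tendsto (fun p : s => RCLike.re (inner ℂ ((x : H →L[ℂ] H) ξ -
        (U p).starProjection ξ) ξ)) Filter.atTop
        (nhds (RCLike.re (inner ℂ ((x : H →L[ℂ] H) ξ - (closedRange s).starProjection ξ) ξ))) :=
      (RCLike.continuous_re.tendsto _).comp
        (Filter.Tendsto.inner (tendsto_const_nhds.sub ht) tendsto_const_nhds)
    refine ge_of_tendsto' ht2 fun p => ?_
    have := (ContinuousLinearMap.isPositive_def.mp
      ((ContinuousLinearMap.le_def _ _).mp (hx' p p.2))).2 ξ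
    rw [hi p] at this
    exact this

/-- A family of partial isometries with orthogonal initial and orthogonal final projections can be
summed. -/
theorem exists_sum_partialIsometry {ι : Type*} (u : ι → M)
    (hu : ∀ i, u i * star (u i) * u i = u i)
    (h1 : ∀ i j, i ≠ j → u i * star (u j) = 0) (h2 : ∀ i j, i ≠ j → star (u i) * u j = 0) :
    ∃ U : M, (∀ i, U * star (u i) = u i * star (u i)) ∧ (∀ i, star (u i) * U = star (u i) * u i) ∧
      (∀ z : M, (∀ i, z * u i = 0) → z * U = 0) ∧ (∀ z : M, (∀ i, u i * z = 0) → U * z = 0) := by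
  classical
  let v : ι → H →L[ℂ] H := fun i => u i
  have hv1 : ∀ i j, i ≠ j → v i * star (v j) = 0 := fun i j hij => congrArg Subtype.val (h1 i j hij)
  have hv2 : ∀ i j, i ≠ j → star (v i) * v j = 0 := fun i j hij => congrArg Subtype.val (h2 i j hij)
  have hvu : ∀ i, v i * star (v i) * v i = v i := fun i => congrArg Subtype.val (hu i)
  -- Finite partial sums are again partial isometries. This bound gives both the square summability
  -- of the orthogonal vectors `v i ξ` and the continuity of the sum.
  have hnorm : ∀ s : Finset ι, ‖∑ i ∈ s, v i‖ ≤ 1 := by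
    intro s
    have e1 : star (∑ i ∈ s, v i) * ∑ i ∈ s, v i = ∑ i ∈ s, star (v i) * v i := by
      rw [star_sum, Finset.sum_mul_sum]
      refine Finset.sum_congr rfl fun i hi => ?_
      exact Finset.sum_eq_single_of_mem i hi fun j _ hj => hv2 i j hj.symm
    have e2 : IsStarProjection (∑ i ∈ s, star (v i) * v i) := by
      constructor
      · change (∑ i ∈ s, star (v i) * v i) * (∑ i ∈ s, star (v i) * v i) = _
        rw [Finset.sum_mul_sum]
        refine Finset.sum_congr rfl fun i hi => ?_
        rw [Finset.sum_eq_single_of_mem i hi fun j _ hj => ?_]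
        · rw [mul_assoc, ← mul_assoc (v i), hvu]
        · rw [mul_assoc, ← mul_assoc (v i), hv1 i j hj.symm]; simp
      · exact isSelfAdjoint_sum _ fun i _ => IsSelfAdjoint.star_mul_self _
    have e3 := e2.norm_le
    rw [← e1, CStarRing.norm_star_mul_self] at e3
    nlinarith [norm_nonneg (∑ i ∈ s, v i)]
  have hfam : OrthogonalFamily ℂ (fun i => (v i).range) fun i => ((v i).range).subtypeₗᵢ := by
    rintro i j hij ⟨_, ξ, rfl⟩ ⟨_, η, rfl⟩
    change inner ℂ (v i ξ) (v j η) = 0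
    rw [← ContinuousLinearMap.adjoint_inner_right]
    have : (star (v i) * v j) η = 0 := by rw [hv2 i j hij]; rfl
    have h' : (ContinuousLinearMap.adjoint (v i)) ((v j) η) = 0 := this
    rw [h', inner_zero_right]
  have hsum : ∀ ξ, Summable fun i => v i ξ := by
    intro ξ
    let f : ∀ i, (v i).range := fun i => ⟨v i ξ, ξ, rfl⟩
    refine (hfam.summable_iff_norm_sq_summable f).mpr ?_
    refine summable_of_sum_le (c := ‖ξ‖ ^ 2) (fun i => by positivity) fun s => ?_
    rw [← hfam.norm_sum f s]
    have e : ∑ i ∈ s, (v i).range.subtypeₗᵢ (f i) = (∑ i ∈ s, v i) ξ := by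
      rw [sum_apply]; rfl
    rw [e]
    have := (∑ i ∈ s, v i).le_of_opNorm_le (hnorm s) ξ
    gcongr
    simpa using this
  let U₀ : H →ₗ[ℂ] H :=
    { toFun := fun ξ => ∑' i, v i ξ
      map_add' := fun ξ η => by
        simp only [map_add]; exact (hsum ξ).tsum_add (hsum η)
      map_smul' := fun c ξ => by
        simp only [map_smul]; exact (hsum ξ).tsum_const_smul c }
  have hbound : ∀ ξ, ‖U₀ ξ‖ ≤ 1 * ‖ξ‖ := by
    intro ξ
    refine le_of_tendsto' (hsum ξ).hasSum.norm fun s => ?_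
    have e : ∑ i ∈ s, v i ξ = (∑ i ∈ s, v i) ξ := by
      rw [sum_apply]
    rw [e]
    exact (∑ i ∈ s, v i).le_of_opNorm_le (hnorm s) ξ
  let U : H →L[ℂ] H := U₀.mkContinuous 1 hbound
  have hU : ∀ ξ, HasSum (fun i => v i ξ) (U ξ) := fun ξ => (hsum ξ).hasSum
  -- With `z = w` in the commutant this puts `U` in `M`; with `w = 0` or `z = 0` it gives the two
  -- annihilation statements.
  have hleft : ∀ z w : H →L[ℂ] H, (∀ i, z * v i = v i * w) → z * U = U * w := by
    intro z w hzw
    ext ξ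
    have a := (hU ξ).mapL z
    have b := hU (w ξ)
    refine a.unique ?_
    have e : (fun i => z (v i ξ)) = fun i => v i (w ξ) :=
      funext fun i => congrArg (fun y : H →L[ℂ] H => y ξ) (hzw i)
    rw [e]
    exact b
  have hUM : U ∈ M := by
    refine mem_of_commute_commutant fun y hy => hleft y y fun i => ?_
    exact (mem_commutant_iff.mp hy (u i) (u i).2).symm
  refine ⟨⟨U, hUM⟩, fun i => Subtype.ext ?_, fun i => Subtype.ext ?_, fun z hz => Subtype.ext ?_,
    fun z hz => Subtype.ext ?_⟩
  · change U * star (v i) = v i * star (v i)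
    ext ξ
    refine (hU (star (v i) ξ)).unique ?_
    refine hasSum_single (f := fun j => v j (star (v i) ξ)) i fun j hj => ?_
    exact congrArg (fun y : H →L[ℂ] H => y ξ) (hv1 j i hj)
  · change star (v i) * U = star (v i) * v i
    ext ξ
    refine ((hU ξ).mapL (star (v i))).unique ?_
    refine hasSum_single (f := fun j => star (v i) (v j ξ)) i fun j hj => ?_
    exact congrArg (fun y : H →L[ℂ] H => y ξ) (hv2 i j hj.symm)
  · change (z : H →L[ℂ] H) * U = 0
    have := hleft z 0 fun i => by
      rw [mul_zero]; exact congrArg Subtype.val (hz i)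
    rwa [mul_zero] at this
  · change U * (z : H →L[ℂ] H) = 0
    have := hleft 0 z fun i => by
      rw [zero_mul]; exact (congrArg Subtype.val (hz i)).symm
    rw [← this, zero_mul]

end VonNeumannAlgebra

/-! ### Cut-off functions of a positive element -/

section CStar

set_option linter.unusedSectionVars false

variable {M : Type*} [CStarAlgebra M] [PartialOrder M] [StarOrderedRing M]

/-- The part `(x - a)⁺` of a self-adjoint element. -/
def cutAbove (x : M) (a : ℝ) : M := cfc (fun v : ℝ => max (v - a) 0) x

/-- The range projection of `cutAbove x a` plays the role of the spectral projection of `x` for (a,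
∞): on it, continuous functions of `x` that agree from `a` on become equal. -/
theorem cfc_mul_cutAbove {x : M} {a : ℝ} {φ : ℝ → ℝ} (hφ : Continuous φ)
    (h : ∀ v, a ≤ v → φ v = 0) : cfc φ x * cutAbove x a = 0 := by
  rw [cutAbove, ← cfc_mul φ (fun v : ℝ => max (v - a) 0) x (by fun_prop) (by fun_prop)]
  have : (fun v : ℝ => φ v * max (v - a) 0) = fun _ => 0 := by
    funext v
    rcases le_total a v with hv | hv
    · rw [h v hv, zero_mul]
    · rw [max_eq_right (by linarith), mul_zero]
  rw [this]
  simp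

/-- This factorisation through `x` places the range projection of the cut-off below any projection
that fixes `x` from the left. -/
theorem exists_mul_eq_cutAbove {x : M} (hx : IsSelfAdjoint x) {a : ℝ} (ha : 0 < a) :
    ∃ m : M, x * m = cutAbove x a := by
  refine ⟨cfc (fun v : ℝ => max (v - a) 0 / max v a) x, ?_⟩
  have hc : Continuous fun v : ℝ => max (v - a) 0 / max v a :=
    Continuous.div (by fun_prop) (by fun_prop) fun v => (lt_max_of_lt_right ha).ne'
  have h := cfc_mul (fun v : ℝ => v) _ x (by fun_prop) hc.continuousOn
  rw [cfc_id' ℝ x] at h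
  rw [← h, cutAbove]
  congr 1
  funext v
  rcases le_total a v with hv | hv
  · rw [max_eq_left hv, max_eq_left (by linarith)]
    have : v ≠ 0 := by linarith
    field_simp
  · rw [max_eq_right (by linarith : v - a ≤ 0)]; simp

theorem cutAbove_ne_zero {x : M} (hx : 0 ≤ x) {a : ℝ} (ha : 0 ≤ a) (h : a < ‖x‖) :
    cutAbove x a ≠ 0 := by
  have hx0 : x ≠ 0 := by rintro rfl; simp at h; linarith
  have : Nontrivial M := ⟨x, 0, hx0⟩
  have h1 := norm_apply_le_norm_cfc (fun v : ℝ => max (v - a) 0) x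
    (CStarAlgebra.norm_mem_spectrum_of_nonneg hx) (by fun_prop) (IsSelfAdjoint.of_nonneg hx)
  intro h0
  rw [← cutAbove, h0, norm_zero, Real.norm_eq_abs, abs_of_nonneg (le_max_right _ _)] at h1
  have := le_max_left (‖x‖ - a) 0
  linarith

theorem IsStarProjection.mul_self {p : M} (hp : IsStarProjection p) : p * p = p :=
  hp.isIdempotentElem

theorem IsStarProjection.star_eq {p : M} (hp : IsStarProjection p) : star p = p :=
  hp.isSelfAdjoint.star_eq

theorem IsStarProjection.mul_eq_symm {p q : M} (hp : IsStarProjection p) (hq : IsStarProjection q)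
    (h : q * p = p) : p * q = p := by
  have := congrArg star h
  rwa [star_mul, hp.star_eq, hq.star_eq] at this

theorem IsStarProjection.sub_of_mul {p q : M} (hp : IsStarProjection p) (hq : IsStarProjection q)
    (h : q * p = p) : IsStarProjection (q - p) :=
  (hp.le_iff_sub hq).mp ((hp.le_iff_mul_eq_right hq).mpr h)

end CStar

/-! ### Spectral projections, polar decomposition and factoriality -/

namespace VonNeumannAlgebra

variable {H : Type*} [NormedAddCommGroup H] [InnerProductSpace ℂ H] [CompleteSpace H]
  {M : VonNeumannAlgebra H}

theorem commute_supProj_singleton {x y : M} (hx : IsSelfAdjoint x) (h : y * x = x * y) :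
    y * supProj {x} = supProj {x} * y := by
  have h' : star y * x = x * star y := by
    have := congrArg star h
    rw [star_mul, star_mul, hx.star_eq] at this
    exact this.symm
  refine commute_supProj (s := {x}) ?_ ?_
  · rintro _ rfl
    rw [h, ← mul_assoc, supProj_mul (Set.mem_singleton _)]
  · rintro _ rfl
    rw [h', ← mul_assoc, supProj_mul (Set.mem_singleton _)]

/-- Spectral projections near the top of the spectrum of a positive element. -/
theorem exists_projection_near_norm {x q : M} (hx : 0 ≤ x) (hq : IsStarProjection q) (hq0 : q ≠ 0)
    (hxq : q * x = x) {δ : ℝ} (hδ : 0 < δ) :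
    ∃ f : M, IsStarProjection f ∧ f ≠ 0 ∧ q * f = f ∧ ‖x * f - ‖x‖ • f‖ ≤ δ ∧
      ∀ y : M, y * x = x * y → y * q = q * y → y * f = f * y := by
  have hsa := IsSelfAdjoint.of_nonneg hx
  rcases eq_or_ne x 0 with rfl | hx0
  · exact ⟨q, hq, hq0, hq.mul_self, by simpa using hδ.le, fun y _ h => h⟩
  have hpos : 0 < ‖x‖ := norm_pos_iff.mpr hx0
  -- Within δ of the norm for the estimate, positive so that the cut-off factors through `x`, and
  -- strictly below the norm so that the cut-off is nonzero.
  let a := max (‖x‖ - δ) (‖x‖ / 2)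
  have ha : 0 < a := lt_max_of_lt_right (by linarith)
  have ha1 : a < ‖x‖ := max_lt (by linarith) (by linarith)
  have ha2 : ‖x‖ - δ ≤ a := le_max_left _ _
  let y := cutAbove x a
  have hysa : IsSelfAdjoint y := cfc_predicate _ _
  refine ⟨supProj {y}, isStarProjection_supProj _, fun h0 => ?_, ?_, ?_, fun z hz _ => ?_⟩
  · have := supProj_mul (s := {y}) rfl
    rw [h0, zero_mul] at this
    exact cutAbove_ne_zero hx ha.le ha1 this.symm
  · refine supProj_mul_eq ?_
    rintro _ rfl
    obtain ⟨m, hm⟩ := exists_mul_eq_cutAbove hsa ha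
    change q * cutAbove x a = cutAbove x a
    rw [← hm, ← mul_assoc, hxq]
  -- From `a` on, φ(v) is v - ‖x‖, so φ(x) equals x - ‖x‖ on the projection; freezing it below `a`
  -- makes it at most δ in absolute value on the whole spectrum.
  · let φ : ℝ → ℝ := fun v => max v a - ‖x‖
    have h1 : x - cfc φ x - algebraMap ℝ M ‖x‖ = cfc (fun v => v - φ v - ‖x‖) x := by
      rw [cfc_sub (fun v => v - φ v) _ x (by fun_prop) (by fun_prop),
        cfc_sub (fun v => v) φ x (by fun_prop) (by fun_prop), cfc_id' ℝ x, cfc_const _ x]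
    have h2 : (x - cfc φ x - algebraMap ℝ M ‖x‖) * supProj {y} = 0 := by
      refine mul_supProj_eq_zero ?_
      rintro _ rfl
      rw [h1]
      refine cfc_mul_cutAbove (by fun_prop) fun v hv => ?_
      simp only [φ, max_eq_left hv]; ring
    have h3 : x * supProj {y} - ‖x‖ • supProj {y} = cfc φ x * supProj {y} := by
      rw [sub_mul, sub_mul, ← Algebra.smul_def] at h2
      rw [← sub_eq_zero, ← h2]; abel
    rw [h3]
    have h4 : ‖cfc φ x‖ ≤ δ := by
      refine norm_cfc_le hδ.le fun v hv => ?_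
      have : v ≤ ‖x‖ := (le_abs_self v).trans (by
        have : Nontrivial M := ⟨x, 0, hx0⟩
        exact spectrum.norm_le_norm_of_mem hv)
      rw [Real.norm_eq_abs, abs_le]
      constructor
      · have := le_max_right v a
        change -δ ≤ max v a - ‖x‖
        linarith
      · have : max v a ≤ ‖x‖ := max_le this ha1.le
        change max v a - ‖x‖ ≤ δ
        linarith
    calc _ ≤ ‖cfc φ x‖ * ‖supProj {y}‖ := norm_mul_le _ _
      _ ≤ δ * 1 := by
        gcongr
        exact (isStarProjection_supProj _).norm_le
      _ = δ := mul_one δ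
  · refine commute_supProj_singleton hysa ?_
    have : Commute x z := hz.symm
    exact (this.cfc_real _).symm.eq

/-- A nonzero element of `q M p` yields a nonzero partial isometry in `q M p`. -/
theorem exists_partialIsometry_of_ne_zero {x p q : M} (hp : IsStarProjection p) (hx : x ≠ 0)
    (hqx : q * x = x) (hxp : x * p = x) :
    ∃ v : M, v ≠ 0 ∧ v * star v * v = v ∧ q * v = v ∧ v * p = v := by
  let s := star x * x
  have hs : 0 ≤ s := star_mul_self_nonneg x
  have hsa : IsSelfAdjoint s := .of_nonneg hs
  have hspos : 0 < ‖s‖ := norm_pos_iff.mpr fun h => hx ((CStarRing.star_mul_self_eq_zero_iff x).mp h)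
  let a := ‖s‖ / 2
  have ha : 0 < a := by positivity
  let y := cutAbove s a
  have hysa : IsSelfAdjoint y := cfc_predicate _ _
  let f := supProj {y}
  have hf : IsStarProjection f := isStarProjection_supProj _
  have hf0 : f ≠ 0 := fun h0 => by
    have := supProj_mul (s := {y}) rfl
    change f * y = y at this
    rw [h0, zero_mul] at this
    exact cutAbove_ne_zero hs ha.le (half_lt_self hspos) this.symm
  -- The inverse square root, frozen below `a` to stay continuous. On the spectral projection `f`,
  -- `x * k` is thus the isometric part of the polar decomposition of `x`.
  let g : ℝ → ℝ := fun v => (Real.sqrt (max v a))⁻¹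
  have hg : Continuous g := by
    refine Continuous.inv₀ (by fun_prop) fun v => ?_
    exact (Real.sqrt_pos.mpr (lt_max_of_lt_right ha)).ne'
  let k := cfc g s
  have hk : IsSelfAdjoint k := cfc_predicate _ _
  have hks : k * s = s * k := ((Commute.refl s).cfc_real g).eq
  have hkf : k * f = f * k := by
    refine commute_supProj_singleton hysa ?_
    exact (((Commute.refl s).cfc_real g).symm.cfc_real _).symm.eq
  have h1 : k * s * k * f = f := by
    have e : k * s * k - 1 = cfc (fun v => g v * v * g v - 1) s := by
      rw [cfc_sub _ _ s (by fun_prop) (by fun_prop), cfc_mul _ _ s (by fun_prop) (by fun_prop),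
        cfc_mul _ _ s (by fun_prop) (by fun_prop), cfc_id' ℝ s, cfc_const _ s]
      simp [k]
    have : (k * s * k - 1) * f = 0 := by
      refine mul_supProj_eq_zero ?_
      rintro _ rfl
      rw [e]
      refine cfc_mul_cutAbove (by fun_prop) fun v hv => ?_
      have hv0 : 0 < v := ha.trans_le hv
      simp only [g, max_eq_left hv]
      have h2 := Real.mul_self_sqrt hv0.le
      have h3 := (Real.sqrt_pos.mpr hv0).ne'
      field_simp
      nlinarith
    rwa [sub_mul, one_mul, sub_eq_zero] at this
  have hvv : star (x * k * f) * (x * k * f) = f := by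
    rw [star_mul, star_mul, hf.star_eq, hk.star_eq]
    calc f * (k * star x) * (x * k * f) = f * (k * s * k * f) := by simp only [s, mul_assoc]
      _ = f := by rw [h1, hf.mul_self]
  have hpf : p * f = f := by
    refine supProj_mul_eq ?_
    rintro _ rfl
    obtain ⟨m, hm⟩ := exists_mul_eq_cutAbove hsa ha
    change p * cutAbove s a = cutAbove s a
    have : p * star x = star x := by
      have := congrArg star hxp
      rwa [star_mul, hp.star_eq] at this
    rw [← hm, ← mul_assoc]
    simp only [s]
    rw [← mul_assoc, this]
  refine ⟨x * k * f, fun h => hf0 ?_, ?_, ?_, ?_⟩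
  · rw [← hvv, h, mul_zero]
  · rw [mul_assoc, hvv, mul_assoc, hf.mul_self]
  · rw [← mul_assoc, ← mul_assoc, hqx]
  · rw [mul_assoc, hf.mul_eq_symm hp hpf]

/-- The projection onto the closed span of the ranges of all `x * p` is central, hence scalar; it
fixes `p ≠ 0`, so it is 1. If every `q * x * p` vanished, `q` would annihilate it. -/
theorem IsTypeIIOneFactor.exists_mul_mul_ne_zero (hM : M.IsTypeIIOneFactor) {p q : M} (hp : p ≠ 0)
    (hq : q ≠ 0) : ∃ x : M, q * x * p ≠ 0 := by
  by_contra! h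
  let s : Set M := Set.range fun x : M => x * p
  have hc : supProj s ∈ Subalgebra.center ℂ M := by
    rw [Subalgebra.mem_center_iff]
    intro y
    refine commute_supProj ?_ ?_
    · rintro _ ⟨x, rfl⟩
      exact supProj_mul ⟨y * x, mul_assoc _ _ _⟩
    · rintro _ ⟨x, rfl⟩
      exact supProj_mul ⟨star y * x, mul_assoc _ _ _⟩
  rw [hM.center_eq_bot, Algebra.mem_bot] at hc
  obtain ⟨c, hc⟩ := hc
  have h1 : supProj s * p = p := supProj_mul ⟨1, one_mul p⟩
  have h2 : q * supProj s = 0 := mul_supProj_eq_zero (by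
    rintro _ ⟨x, rfl⟩
    change q * (x * p) = 0
    rw [← mul_assoc, h x])
  rw [← hc, ← Algebra.smul_def] at h1
  have hc1 : c = 1 := by
    have : (c - 1) • p = 0 := by rw [sub_smul, h1, one_smul, sub_self]
    rcases smul_eq_zero.mp this with h | h
    · exact sub_eq_zero.mp h
    · exact absurd h hp
  rw [← hc, hc1, map_one, mul_one] at h2
  exact hq h2

/-- A family of partial isometries with orthogonal initial and orthogonal final projections has a
sum, which is a partial isometry. -/
theorem exists_sum_partialIsometry' {ι : Type*} (u : ι → M)
    (hu : ∀ i, u i * star (u i) * u i = u i)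
    (h1 : ∀ i j, i ≠ j → u i * star (u j) = 0) (h2 : ∀ i j, i ≠ j → star (u i) * u j = 0) :
    ∃ U : M, U * star U * U = U ∧ (∀ i, U * star (u i) = u i * star (u i)) ∧
      (∀ i, star (u i) * U = star (u i) * u i) ∧
      (∀ i, u i * (star U * U) = u i) ∧ (∀ i, U * star U * u i = u i) ∧
      (∀ z : M, (∀ i, z * u i = 0) → z * U = 0) ∧ (∀ z : M, (∀ i, u i * z = 0) → U * z = 0) := by
  obtain ⟨U, ha, hb, hc, hd⟩ := exists_sum_partialIsometry u hu h1 h2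
  have ha' : ∀ i, u i * star U = u i * star (u i) := fun i => by
    have := congrArg star (ha i)
    simpa using this
  have hb' : ∀ i, star U * u i = star (u i) * u i := fun i => by
    have := congrArg star (hb i)
    simpa using this
  have h5 : ∀ i, U * star U * u i = u i := fun i => by
    rw [mul_assoc, hb', ← mul_assoc, ha, hu]
  refine ⟨U, ?_, ha, hb, fun i => ?_, h5, hc, hd⟩
  · have := hc (U * star U - 1) fun i => by rw [sub_mul, h5, one_mul, sub_self]
    rwa [sub_mul, one_mul, sub_eq_zero] at this
  · rw [← mul_assoc, ha', mul_assoc, hb, ← mul_assoc, hu]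

end VonNeumannAlgebra

/-! ### Projections in relative commutants: values of the trace and equivalence -/

/-- The projections of `M` commuting with all elements of `S`. -/
def commutingProj {M : Type*} [Mul M] [Star M] (S : Set M) : Set M :=
  {p | IsStarProjection p ∧ ∀ s ∈ S, s * p = p * s}

/-- The exhaustion principle behind both the equivalence of projections and the gluing of cells. -/
theorem exists_maximal_pairwise {α : Type*} (S : Set α) (r : α → α → Prop) :
    ∃ F : Set α, F ⊆ S ∧ F.Pairwise r ∧ ∀ x ∈ S, (∀ y ∈ F, r x y ∧ r y x) → x ∈ F := by
  obtain ⟨F, hF⟩ := zorn_subset {F : Set α | F ⊆ S ∧ F.Pairwise r} fun c hc hch =>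
    ⟨⋃₀ c, ⟨Set.sUnion_subset fun s hs => (hc hs).1,
      (Set.pairwise_sUnion hch.directedOn).mpr fun s hs => (hc hs).2⟩,
      fun s hs => Set.subset_sUnion_of_mem hs⟩
  refine ⟨F, hF.prop.1, hF.prop.2, fun x hx h => ?_⟩
  refine hF.le_of_ge (y := insert x F) ⟨Set.insert_subset hx hF.prop.1, ?_⟩
    (Set.subset_insert x F) (Set.mem_insert x F)
  exact hF.prop.2.insert fun y hy _ => h y hy

section Trace

set_option linter.unusedSectionVars false

variable {M : Type*} [CStarAlgebra M] [PartialOrder M] [StarOrderedRing M] {τ : M →ₚ[ℂ] ℂ}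

theorem IsFaithfulNormalTrace.re_pos (hτ : IsFaithfulNormalTrace τ) {p : M}
    (hp : IsStarProjection p) (h : p ≠ 0) : 0 < (τ p).re := by
  have h1 := Complex.nonneg_iff.mp (τ.map_nonneg hp.nonneg)
  refine lt_of_le_of_ne h1.1 fun h0 => h (hτ.faithful p ?_)
  rw [hp.star_eq, hp.mul_self]
  exact Complex.ext h0.symm h1.2.symm

theorem PositiveLinearMap.eq_re_of_nonneg {x : M} (hx : 0 ≤ x) : τ x = ((τ x).re : ℂ) := by
  have h1 := Complex.nonneg_iff.mp (τ.map_nonneg hx)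
  exact Complex.ext rfl h1.2.symm

theorem PositiveLinearMap.re_sub (x y : M) : (τ (x - y)).re = (τ x).re - (τ y).re := by
  rw [map_sub, Complex.sub_re]

end Trace

namespace VonNeumannAlgebra

variable {H : Type*} [NormedAddCommGroup H] [InnerProductSpace ℂ H] [CompleteSpace H]
  {M : VonNeumannAlgebra H} {τ : M →ₚ[ℂ] ℂ}

/-- The relative commutant of a commuting family has no minimal projections. -/
theorem IsTypeIIOneFactor.exists_proper_subprojection (hM : M.IsTypeIIOneFactor) {S : Set M}
    (hS : ∀ s ∈ S, IsSelfAdjoint s) (hc : ∀ s ∈ S, ∀ t ∈ S, s * t = t * s) {p : M}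
    (hp : p ∈ commutingProj S) (hp0 : p ≠ 0) :
    ∃ g ∈ commutingProj S, g ≠ 0 ∧ g ≠ p ∧ p * g = g := by
  by_contra! hmin
  have hscal : ∀ s ∈ S, ∃ c : ℝ, s * p = c • p := by
    intro s hs
    -- The shift by ‖s‖ makes the compression of `s` positive without changing which projections
    -- commute with it.
    let x : M := p * (s + algebraMap ℝ M ‖s‖) * p
    have hpsa : IsSelfAdjoint p := hp.1.isSelfAdjoint
    have hx : 0 ≤ x := by
      have h0 : 0 ≤ s + algebraMap ℝ M ‖s‖ := by
        have := (hS s hs).neg_algebraMap_norm_le_self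
        rwa [neg_le_iff_add_nonneg] at this
      have := star_left_conjugate_nonneg h0 p
      rwa [hpsa.star_eq] at this
    have hxs : x = s * p + ‖s‖ • p := by
      simp only [x]
      rw [mul_add, add_mul, ← hp.2 s hs, mul_assoc s, hp.1.mul_self, ← Algebra.commutes, mul_assoc,
        hp.1.mul_self, ← Algebra.smul_def]
    have hpx : p * x = x := by simp only [x]; rw [← mul_assoc, ← mul_assoc, hp.1.mul_self]
    have hxp : x * p = x := by simp only [x]; rw [mul_assoc, hp.1.mul_self]
    -- A spectral projection of `x` near its norm lies below `p` and commutes with `S`, so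
    -- minimality of `p` forces it to be `p`; hence `x` is a scalar on `p`.
    have hn : ∀ δ > 0, ‖x * p - ‖x‖ • p‖ ≤ δ := by
      intro δ hδ
      obtain ⟨f, hf, hf0, hpf, hfn, hfc⟩ := exists_projection_near_norm hx hp.1 hp0 hpx hδ
      have hfD : f ∈ commutingProj S := by
        refine ⟨hf, fun t ht => hfc t ?_ (hp.2 t ht)⟩
        rw [hxs, mul_add, add_mul, mul_smul_comm, smul_mul_assoc, hp.2 t ht, ← mul_assoc,
          hc t ht s hs, mul_assoc, mul_assoc, hp.2 t ht]
      by_cases hfp : f = p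
      · rwa [hfp] at hfn
      · exact absurd hpf (hmin f hfD hf0 hfp)
    have h0 : x * p - ‖x‖ • p = 0 := by
      rw [← norm_le_zero_iff]
      exact le_of_forall_gt_imp_ge_of_dense hn
    refine ⟨‖x‖ - ‖s‖, ?_⟩
    rw [hxp, sub_eq_zero] at h0
    rw [sub_smul, ← h0, hxs]
    abel
  -- Since `S` acts on `p` by scalars, every subprojection of `p` in `M` commutes with `S`, and `M`
  -- itself has no minimal projections.
  obtain ⟨g, hg, hg0, hgp, hle⟩ := hM.no_minimal p hp.1 hp0
  have hpg : p * g = g := (hg.le_iff_mul_eq_right hp.1).mp hle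
  refine hmin g ⟨hg, fun s hs => ?_⟩ hg0 hgp hpg
  obtain ⟨c, hc⟩ := hscal s hs
  have h1 : s * g = c • g := by
    rw [← hpg, ← mul_assoc, hc, smul_mul_assoc]
  have h2 := congrArg star h1
  rw [star_mul, hg.star_eq, (hS s hs).star_eq, star_smul, hg.star_eq, star_trivial] at h2
  rw [h1, h2]

/-- For a proper subprojection `g` of `f`, one of `g` and `f - g` has at most half the trace;
halving is iterated. -/
theorem IsTypeIIOneFactor.exists_small_subprojection (hM : M.IsTypeIIOneFactor) {S : Set M}
    (hS : ∀ s ∈ S, IsSelfAdjoint s) (hc : ∀ s ∈ S, ∀ t ∈ S, s * t = t * s) {p : M}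
    (hp : p ∈ commutingProj S) (hp0 : p ≠ 0) {ε : ℝ} (hε : 0 < ε) :
    ∃ f ∈ commutingProj S, f ≠ 0 ∧ p * f = f ∧ (τ f).re ≤ ε := by
  have key : ∀ n : ℕ, ∃ f ∈ commutingProj S, f ≠ 0 ∧ p * f = f ∧
      (τ f).re ≤ (1 / 2) ^ n * (τ p).re := by
    intro n
    induction n with
    | zero => exact ⟨p, hp, hp0, hp.1.mul_self, by simp⟩
    | succ n ih =>
      obtain ⟨f, hf, hf0, hpf, hle⟩ := ih
      obtain ⟨g, hg, hg0, hgf, hfg⟩ := hM.exists_proper_subprojection hS hc hf hf0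
      rcases le_total (τ g).re ((τ f).re / 2) with h | h
      · refine ⟨g, hg, hg0, by rw [← hfg, ← mul_assoc, hpf], ?_⟩
        rw [pow_succ]; linarith
      · refine ⟨f - g, ⟨hg.1.sub_of_mul hf.1 hfg, fun s hs => ?_⟩, sub_ne_zero.mpr hgf.symm, ?_, ?_⟩
        · rw [mul_sub, sub_mul, hf.2 s hs, hg.2 s hs]
        · rw [mul_sub, hpf, ← hfg, ← mul_assoc, hpf]
        · rw [PositiveLinearMap.re_sub, pow_succ]; linarith
  have ht : Filter.Tendsto (fun n : ℕ => (1 / 2 : ℝ) ^ n * (τ p).re) Filter.atTop (nhds 0) := by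
    simpa using (tendsto_pow_atTop_nhds_zero_of_lt_one (r := (1 / 2 : ℝ)) (by norm_num)
      (by norm_num)).mul_const (τ p).re
  obtain ⟨n, hn⟩ := (ht.eventually (ge_mem_nhds hε)).exists
  obtain ⟨f, hf, hf0, hpf, hle⟩ := key n
  exact ⟨f, hf, hf0, hpf, hle.trans hn⟩

/-- The trace takes all intermediate values on the projections commuting with a commuting family. -/
theorem IsTypeIIOneFactor.exists_subprojection_trace_eq (hM : M.IsTypeIIOneFactor)
    (hτ : IsFaithfulNormalTrace τ) {S : Set M}
    (hS : ∀ s ∈ S, IsSelfAdjoint s) (hc : ∀ s ∈ S, ∀ t ∈ S, s * t = t * s) {p : M}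
    (hp : p ∈ commutingProj S) {r : ℝ} (hr : 0 ≤ r) (hrp : r ≤ (τ p).re) :
    ∃ f ∈ commutingProj S, p * f = f ∧ (τ f).re = r := by
  -- Normality keeps the trace of the supremum of a chain at most `r`. If a maximal `f` had smaller
  -- trace, a small piece of `p - f` could be added to it.
  obtain ⟨f, ⟨hf, hpf, hfr⟩, hmax⟩ := zorn_le₀
    {f : M | f ∈ commutingProj S ∧ p * f = f ∧ (τ f).re ≤ r} (by
      intro c hcs hch
      rcases c.eq_empty_or_nonempty with rfl | hne
      · exact ⟨0, ⟨⟨.zero M, by simp⟩, by simp, by simpa using hr⟩, by simp⟩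
      · have hlub := isLUB_supProj (fun x hx => (hcs hx).1.1) hch hne
        refine ⟨supProj c, ⟨⟨isStarProjection_supProj c, fun s hs => ?_⟩, ?_, ?_⟩,
          fun z hz => hlub.1 hz⟩
        · refine commute_supProj ?_ ?_
          · intro x hx
            rw [(hcs hx).1.2 s hs, ← mul_assoc, supProj_mul hx]
          · intro x hx
            rw [(hS s hs).star_eq, (hcs hx).1.2 s hs, ← mul_assoc, supProj_mul hx]
        · exact supProj_mul_eq fun x hx => (hcs hx).2.1
        · have := (hτ.normal hne hch.directedOn hlub).2 (show (r : ℂ) ∈ upperBounds _ by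
            rintro _ ⟨x, hx, rfl⟩
            rw [PositiveLinearMap.eq_re_of_nonneg (τ := τ) (hcs hx).1.1.nonneg]
            exact Complex.real_le_real.mpr (hcs hx).2.2)
          simpa using (Complex.le_def.mp this).1)
  refine ⟨f, hf, hpf, hfr.antisymm (le_of_not_gt fun hlt => ?_)⟩
  have hg : p - f ∈ commutingProj S :=
    ⟨hf.1.sub_of_mul hp.1 hpf, fun s hs => by rw [mul_sub, sub_mul, hp.2 s hs, hf.2 s hs]⟩
  have hg0 : p - f ≠ 0 := fun h => by rw [← sub_eq_zero.mp h] at hlt; linarith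
  obtain ⟨h, hh, hh0, hgh, hle⟩ := hM.exists_small_subprojection (τ := τ) hS hc hg hg0
    (sub_pos.mpr hlt)
  have hfh : f * h = 0 := by
    rw [← hgh, ← mul_assoc, mul_sub, hf.1.mul_eq_symm hp.1 hpf, hf.1.mul_self, sub_self, zero_mul]
  have hph : p * h = h := by
    rw [← hgh, ← mul_assoc, mul_sub, hp.1.mul_self, hpf]
  have hfhp := hf.1.add hh.1 hfh
  have h1 : f ≤ f + h := by
    rw [le_add_iff_nonneg_right]; exact hh.1.nonneg
  have h2 := hmax (y := f + h) ⟨⟨hfhp, fun s hs => by rw [mul_add, add_mul, hf.2 s hs, hh.2 s hs]⟩,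
    by rw [mul_add, hpf, hph], by rw [map_add, Complex.add_re]; linarith⟩ h1
  exact hh0 (by simpa using (le_antisymm h1 h2).symm)

/-- Projections of equal trace are equivalent. -/
theorem IsTypeIIOneFactor.exists_partialIsometry_of_trace_eq (hM : M.IsTypeIIOneFactor)
    (hτ : IsFaithfulNormalTrace τ) {p q : M} (hp : IsStarProjection p) (hq : IsStarProjection q)
    (hpq : (τ p).re = (τ q).re) : ∃ u : M, star u * u = p ∧ u * star u = q := by
  -- The maximal family cannot leave parts of both `p` and `q` uncovered, since factoriality would
  -- join them by a further partial isometry. Nonzero members are required so that a new one cannot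
  -- already belong to the family.
  obtain ⟨F, hFS, hFp, hFmax⟩ := exists_maximal_pairwise
    {u : M | u * star u * u = u ∧ q * u = u ∧ u * p = u ∧ u ≠ 0}
    (fun u v => u * star v = 0 ∧ star u * v = 0)
  obtain ⟨U, hU, -, -, hUr, hUl, hz1, hz2⟩ := exists_sum_partialIsometry' (fun u : F => (u : M))
    (fun u => (hFS u.2).1) (fun u v h => (hFp u.2 v.2 fun e => h (Subtype.ext e)).1)
    (fun u v h => (hFp u.2 v.2 fun e => h (Subtype.ext e)).2)
  have hP : IsStarProjection (star U * U) :=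
    ⟨by change star U * U * (star U * U) = _; rw [mul_assoc, ← mul_assoc U, hU], .star_mul_self U⟩
  have hQ : IsStarProjection (U * star U) :=
    ⟨by change U * star U * (U * star U) = _; rw [← mul_assoc, hU], .mul_star_self U⟩
  have hqU : q * U = U := by
    have := hz1 (q - 1) fun u => by rw [sub_mul, (hFS u.2).2.1, one_mul, sub_self]
    rwa [sub_mul, one_mul, sub_eq_zero] at this
  have hUp : U * p = U := by
    have := hz2 (p - 1) fun u => by rw [mul_sub, (hFS u.2).2.2.1, mul_one, sub_self]
    rwa [mul_sub, mul_one, sub_eq_zero] at this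
  have hpU : p * star U = star U := by
    have := congrArg star hUp
    rwa [star_mul, hp.star_eq] at this
  have hP' := hP.sub_of_mul hp (by rw [← mul_assoc, hpU])
  have hQ' := hQ.sub_of_mul hq (by rw [← mul_assoc, hqU])
  have htr : (τ (star U * U)).re = (τ (U * star U)).re := by rw [hτ.tracial]
  have hzero : p - star U * U = 0 ∨ q - U * star U = 0 := by
    by_contra! hne
    obtain ⟨y, hy⟩ := hM.exists_mul_mul_ne_zero hne.1 hne.2
    obtain ⟨v, hv0, hv, hqv, hvp⟩ := exists_partialIsometry_of_ne_zero hP' hy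
      (by rw [← mul_assoc, ← mul_assoc, hQ'.mul_self]) (by rw [mul_assoc, hP'.mul_self])
    have e1 : q * v = v := by
      rw [← hqv, ← mul_assoc, mul_sub, hq.mul_self, ← mul_assoc q, hqU]
    have e2 : v * p = v := by
      rw [← hvp, mul_assoc, sub_mul, hp.mul_self, mul_assoc, hUp]
    have e3 : ∀ u ∈ F, v * star u = 0 := fun u hu => by
      have h1 := hUr ⟨u, hu⟩
      have h2 : (p - star U * U) * star u = 0 := by
        have h3 := congrArg star h1
        have h4 := congrArg star (hFS hu).2.2.1
        rw [star_mul, hP.star_eq] at h3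
        rw [star_mul, hp.star_eq] at h4
        rw [sub_mul, h3, h4, sub_self]
      rw [← hvp, mul_assoc, h2, mul_zero]
    have e4 : ∀ u ∈ F, star v * u = 0 := fun u hu => by
      have h1 := hUl ⟨u, hu⟩
      have h2 : (q - U * star U) * u = 0 := by
        rw [sub_mul, (hFS hu).2.1, h1, sub_self]
      have h3 := congrArg star hqv
      rw [star_mul, hQ'.star_eq] at h3
      rw [← h3, mul_assoc, h2, mul_zero]
    have hvF := hFmax v ⟨hv, e1, e2, hv0⟩ fun u hu =>
      ⟨⟨e3 u hu, e4 u hu⟩, by simpa using congrArg star (e3 u hu),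
        by simpa using congrArg star (e4 u hu)⟩
    exact hv0 (by rw [← hv, e3 v hvF, zero_mul])
  -- Once one remainder vanishes, the other has trace zero because the traces agree, and
  -- faithfulness removes it.
  rcases hzero with h | h
  · refine ⟨U, (sub_eq_zero.mp h).symm, ?_⟩
    by_contra hne
    have := hτ.re_pos hQ' (sub_ne_zero.mpr fun h => hne h.symm)
    rw [PositiveLinearMap.re_sub, ← hpq, ← htr, ← PositiveLinearMap.re_sub, h] at this
    simp at this
  · refine ⟨U, ?_, (sub_eq_zero.mp h).symm⟩
    by_contra hne
    have := hτ.re_pos hP' (sub_ne_zero.mpr fun h => hne h.symm)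
    rw [PositiveLinearMap.re_sub, hpq, htr, ← PositiveLinearMap.re_sub, h] at this
    simp at this

end VonNeumannAlgebra

/-! ### Maximal abelian subalgebras -/

section MASA

variable {M : Type*} [CStarAlgebra M] {𝒜 : StarSubalgebra ℂ M}

/-- Adjoining to `𝒜` a self-adjoint element that commutes with it gives an abelian ⋆-subalgebra, so
maximality applies. -/
theorem IsMASA.mem_of_commute (h𝒜 : IsMASA 𝒜) {x : M} (hx : IsSelfAdjoint x)
    (h : ∀ a ∈ 𝒜, a * x = x * a) : x ∈ 𝒜 := by
  have h1 : ∀ a ∈ insert x (𝒜 : Set M), ∀ b ∈ insert x (𝒜 : Set M), a * b = b * a := by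
    rintro a (rfl | ha) b (rfl | hb)
    · rfl
    · exact (h b hb).symm
    · exact h a ha
    · exact h𝒜.prop a ha b hb
  have h2 : ∀ a ∈ insert x (𝒜 : Set M), star a ∈ insert x (𝒜 : Set M) := by
    rintro a (rfl | ha)
    · exact Or.inl hx.star_eq
    · exact Or.inr (star_mem ha)
  have hcomm := StarAlgebra.isMulCommutative_adjoin ℂ h1 fun a ha b hb => h1 a ha _ (h2 b hb)
  have hsub : insert x (𝒜 : Set M) ⊆ StarAlgebra.adjoin ℂ (insert x (𝒜 : Set M)) :=
    StarAlgebra.subset_adjoin ℂ _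
  refine h𝒜.le_of_ge (y := StarAlgebra.adjoin ℂ (insert x (𝒜 : Set M))) ?_
    (fun a ha => hsub (Or.inr ha)) (hsub (Or.inl rfl))
  intro a ha b hb
  exact congrArg Subtype.val (hcomm.is_comm.comm ⟨a, ha⟩ ⟨b, hb⟩)

/-- The closure of an abelian ⋆-subalgebra is abelian. Closedness supplies the completeness needed
by the inverse function argument. -/
theorem IsMASA.isClosed (h𝒜 : IsMASA 𝒜) : IsClosed (𝒜 : Set M) := by
  have : 𝒜.topologicalClosure ≤ 𝒜 := by
    refine h𝒜.le_of_ge ?_ 𝒜.le_topologicalClosure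
    have h1 : closure (𝒜 : Set M) ⊆ Set.centralizer 𝒜 :=
      closure_minimal (fun x hx y hy => h𝒜.prop y hy x hx) (Set.isClosed_centralizer _)
    have h2 : closure (𝒜 : Set M) ⊆ Set.centralizer (closure 𝒜) :=
      closure_minimal (fun x hx y hy => (h1 hy x hx).symm) (Set.isClosed_centralizer _)
    intro x hx y hy
    exact h2 hy x hx
  rw [← closure_subset_iff_isClosed]
  exact this

end MASA

/-! ### A quantitative inverse function argument for two-sided exponentials -/

section Perturbation

variable {M : Type*} [CStarAlgebra M]

/-- Strict differentiability of the exponential at 0, where its derivative is the identity. -/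
theorem exists_radius_exp {η : ℝ} (hη : 0 < η) : ∃ ρ > 0, ∀ x y : M, ‖x‖ ≤ ρ → ‖y‖ ≤ ρ →
    ‖NormedSpace.exp x - 1‖ ≤ η ∧
      ‖NormedSpace.exp x - NormedSpace.exp y - (x - y)‖ ≤ η * ‖x - y‖ := by
  have h := (hasStrictFDerivAt_exp_zero (𝕂 := ℝ) (𝔸 := M)).approximates_deriv_on_nhds
    (c := ⟨η, hη.le⟩) (Or.inr hη)
  obtain ⟨s, hs, ha⟩ := h
  have hcont : Filter.Tendsto (fun x : M => ‖NormedSpace.exp x - 1‖) (nhds 0) (nhds 0) := by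
    have h1 := (hasStrictFDerivAt_exp_zero (𝕂 := ℝ) (𝔸 := M)).continuousAt.tendsto
    have h2 := (h1.sub_const 1).norm
    simpa [NormedSpace.exp_zero] using h2
  have hs2 := Filter.inter_mem hs (hcont.eventually (ge_mem_nhds hη))
  obtain ⟨ρ, hρ, hb⟩ := Metric.nhds_basis_closedBall.mem_iff.mp hs2
  refine ⟨ρ, hρ, fun x y hx hy => ⟨(hb (by simpa using hx)).2, ?_⟩⟩
  exact ha x (hb (by simpa using hx)).1 y (hb (by simpa using hy)).1

/-- Solving `F (exp (h b) * Y * exp (g b)) = a` for `Y` near `t • W` when `b ↦ F (h b * W + W * g b)`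
is the identity; the size of the allowed perturbation is uniform. -/
theorem exists_exp_mul_exp_eq {K C t : ℝ} (hK : 0 < K) (hC : 0 < C) (ht : 0 < t) :
    ∃ δ > 0, ∀ (B : Submodule ℝ M) (F h g : M →ₗ[ℝ] M) (W Y a : M), IsClosed (B : Set M) →
      (∀ x, ‖F x‖ ≤ K * ‖x‖) → (∀ x, F x ∈ B) → (∀ b, ‖h b‖ ≤ C * ‖b‖) →
      (∀ b, ‖g b‖ ≤ C * ‖b‖) → ‖W‖ ≤ 1 → (∀ b ∈ B, F (h b * W + W * g b) = b) →
      ‖Y - t • W‖ ≤ δ → a ∈ B → ‖a - t • F W‖ ≤ δ →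
      ∃ b ∈ B, F (NormedSpace.exp (h b) * Y * NormedSpace.exp (g b)) = a := by
  -- The four error terms below add up to `η * (2 * C * (3 * t + 4)) * ‖d‖` before `F` is applied;
  -- after it they must be at most half the derivative `t`. The bound `η ≤ 1` keeps exponentials of
  -- norm at most 2 and `‖Y‖ ≤ t + 1`.
  obtain ⟨η, hη, hη1, hη2⟩ : ∃ η > 0, η ≤ 1 ∧ K * (η * (2 * C * (3 * t + 4))) ≤ t / 2 := by
    refine ⟨min 1 (t / 2 / (K * (2 * C * (3 * t + 4)))), by positivity, min_le_left _ _, ?_⟩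
    have h0 : 0 < K * (2 * C * (3 * t + 4)) := by positivity
    have := (le_div_iff₀ h0).mp (min_le_right 1 (t / 2 / (K * (2 * C * (3 * t + 4)))))
    linarith
  obtain ⟨ρ, hρ, hexp⟩ := exists_radius_exp (M := M) hη
  -- For `b` of norm at most `R`, the exponents `h b` and `g b` stay in the ball of radius ρ.
  let R := ρ / C
  have hR : 0 < R := by positivity
  -- The second bound keeps `a` within `(t - t / 2) * R` of the value at `b = 0`, the radius of the
  -- ball that the image covers.
  refine ⟨min η (t / 2 * R / (1 + K)), by positivity, ?_⟩
  intro B F h g W Y a hB hF hFB hh hg hW hlin hY haB ha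
  have hYη : ‖Y - t • W‖ ≤ η := hY.trans (min_le_left _ _)
  have hYn : ‖Y‖ ≤ t + 1 := by
    have : ‖t • W‖ ≤ t := by
      rw [norm_smul, Real.norm_of_nonneg ht.le]; nlinarith
    calc ‖Y‖ = ‖(Y - t • W) + t • W‖ := by rw [sub_add_cancel]
      _ ≤ ‖Y - t • W‖ + ‖t • W‖ := norm_add_le _ _
      _ ≤ t + 1 := by linarith
  have : CompleteSpace B := hB.completeSpace_coe
  let f : B → B := fun b => ⟨F (NormedSpace.exp (h b) * Y * NormedSpace.exp (g b)), hFB _⟩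
  let f' : B →L[ℝ] B := t • ContinuousLinearMap.id ℝ B
  have happ : ApproximatesLinearOn f f' (Metric.closedBall 0 R) ⟨t / 2, by positivity⟩ := by
    intro b hb b' hb'
    change ‖F (NormedSpace.exp (h b) * Y * NormedSpace.exp (g b)) -
      F (NormedSpace.exp (h b') * Y * NormedSpace.exp (g b')) - t • ((b - b' : B) : M)‖ ≤
      t / 2 * ‖((b - b' : B) : M)‖
    have hbn : ‖(b : M)‖ ≤ R := by simpa using hb
    have hbn' : ‖(b' : M)‖ ≤ R := by simpa using hb'
    have hCR : C * R = ρ := by simp only [R]; field_simp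
    set d : M := ((b - b' : B) : M) with hd
    have hd' : d = (b : M) - b' := rfl
    set x := h b
    set x' := h b'
    set y := g b
    set y' := g b'
    have hle : ∀ z : M, ‖z‖ ≤ R → C * ‖z‖ ≤ ρ := fun z hz => by rw [← hCR]; gcongr
    have hx : ‖x‖ ≤ ρ := (hh b).trans (hle _ hbn)
    have hx' : ‖x'‖ ≤ ρ := (hh b').trans (hle _ hbn')
    have hy : ‖y‖ ≤ ρ := (hg b).trans (hle _ hbn)
    have hy' : ‖y'‖ ≤ ρ := (hg b').trans (hle _ hbn')
    have hdx : ‖x - x'‖ ≤ C * ‖d‖ := by rw [← map_sub]; exact hh _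
    have hdy : ‖y - y'‖ ≤ C * ‖d‖ := by rw [← map_sub]; exact hg _
    have hxx := (hexp x x' hx hx').2
    have hyy := (hexp y y' hy hy').2
    have he' := (hexp x' x' hx' hx').1
    have hc := (hexp y y hy hy).1
    have hd0 : F (h d * W + W * g d) = d := hlin d (b - b' : B).2
    have hhd : h d = x - x' := map_sub h _ _
    have hgd : g d = y - y' := map_sub g _ _
    set e := NormedSpace.exp x
    set e' := NormedSpace.exp x'
    set c := NormedSpace.exp y
    set c' := NormedSpace.exp y'
    have hone : ‖(1 : M)‖ ≤ 1 := by
      rcases subsingleton_or_nontrivial M with _ | _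
      · rw [Subsingleton.elim (1 : M) 0, norm_zero]; exact zero_le_one
      · exact CStarRing.norm_one.le
    have hcn : ‖c‖ ≤ 2 := by
      calc ‖c‖ = ‖(c - 1) + 1‖ := by rw [sub_add_cancel]
        _ ≤ ‖c - 1‖ + ‖(1 : M)‖ := norm_add_le _ _
        _ ≤ 2 := by linarith
    have hen : ‖e'‖ ≤ 2 := by
      calc ‖e'‖ = ‖(e' - 1) + 1‖ := by rw [sub_add_cancel]
        _ ≤ ‖e' - 1‖ + ‖(1 : M)‖ := norm_add_le _ _
        _ ≤ 2 := by linarith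
    have hYc : ‖Y * c - t • W‖ ≤ (t + 2) * η := by
      calc ‖Y * c - t • W‖ = ‖Y * (c - 1) + (Y - t • W)‖ := by congr 1; noncomm_ring
        _ ≤ ‖Y‖ * ‖c - 1‖ + ‖Y - t • W‖ :=
          (norm_add_le _ _).trans (add_le_add_left (norm_mul_le _ _) _)
        _ ≤ (t + 1) * η + η := by gcongr
        _ = (t + 2) * η := by ring
    have heY : ‖e' * Y - t • W‖ ≤ (t + 2) * η := by
      calc ‖e' * Y - t • W‖ = ‖(e' - 1) * Y + (Y - t • W)‖ := by congr 1; noncomm_ring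
        _ ≤ ‖e' - 1‖ * ‖Y‖ + ‖Y - t • W‖ :=
          (norm_add_le _ _).trans (add_le_add_left (norm_mul_le _ _) _)
        _ ≤ η * (t + 1) + η := by gcongr
        _ = (t + 2) * η := by ring
    -- The exponentials are changed one side at a time and each change is replaced by its
    -- first-order term. The main term is `t • (h d * W + W * g d)`, which `F` sends to `t • d`.
    have hkey : F (e * Y * c) - F (e' * Y * c') - t • d =
        F ((e - e' - (x - x')) * (Y * c) + (x - x') * (Y * c - t • W) +
          e' * Y * (c - c' - (y - y')) + (e' * Y - t • W) * (y - y')) := by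
      conv_lhs => rw [← hd0, hhd, hgd]
      rw [← map_smul, ← map_sub, ← map_sub]
      congr 1
      simp only [mul_sub, sub_mul, smul_add, smul_sub, smul_mul_assoc, mul_smul_comm, mul_assoc]
      abel
    rw [hkey]
    have hd0 : 0 ≤ ‖d‖ := norm_nonneg _
    calc _ ≤ K * ‖_‖ := hF _
      _ ≤ K * (η * (C * ‖d‖) * ((t + 1) * 2) + C * ‖d‖ * ((t + 2) * η) +
          2 * (t + 1) * (η * (C * ‖d‖)) + (t + 2) * η * (C * ‖d‖)) := by
        gcongr
        refine (norm_add_le _ _).trans (add_le_add ((norm_add_le _ _).trans (add_le_add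
          ((norm_add_le _ _).trans (add_le_add ?_ ?_)) ?_)) ?_)
        · refine (norm_mul_le _ _).trans ?_
          gcongr
          · exact hxx.trans (by gcongr)
          · exact (norm_mul_le _ _).trans (by gcongr)
        · exact (norm_mul_le _ _).trans (by gcongr)
        · refine (norm_mul_le _ _).trans ?_
          gcongr
          · exact (norm_mul_le _ _).trans (by gcongr)
          · exact hyy.trans (by gcongr)
        · exact (norm_mul_le _ _).trans (by gcongr)
      _ = K * (η * (2 * C * (3 * t + 4))) * ‖d‖ := by ring
      _ ≤ t / 2 * ‖d‖ := by gcongr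
  let inv : f'.NonlinearRightInverse :=
    { toFun := fun y => t⁻¹ • y
      nnnorm := ⟨t⁻¹, by positivity⟩
      bound' := fun y => by
        rw [norm_smul, Real.norm_of_nonneg (by positivity)]; rfl
      right_inv' := fun y => by
        change t • (t⁻¹ • y) = y
        rw [smul_smul, mul_inv_cancel₀ ht.ne', one_smul] }
  have hsurj := happ.surjOn_closedBall_of_nonlinearRightInverse inv hR.le (subset_refl _)
  have hmem : (⟨a, haB⟩ : B) ∈ Metric.closedBall (f 0)
      (((inv.nnnorm : ℝ)⁻¹ - ((⟨t / 2, by positivity⟩ : NNReal) : ℝ)) * R) := by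
    rw [Metric.mem_closedBall, dist_eq_norm]
    change ‖a - F (NormedSpace.exp (h (0 : M)) * Y * NormedSpace.exp (g (0 : M)))‖ ≤
      ((t⁻¹)⁻¹ - t / 2) * R
    rw [map_zero, map_zero, NormedSpace.exp_zero, one_mul, mul_one, inv_inv]
    have h1 : a - F Y = (a - t • F W) - F (Y - t • W) := by
      rw [map_sub, map_smul]; abel
    rw [h1]
    have h2 := min_le_right η (t / 2 * R / (1 + K))
    have h3 : min η (t / 2 * R / (1 + K)) * (1 + K) ≤ t / 2 * R :=
      (le_div_iff₀ (by positivity)).mp h2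
    calc _ ≤ ‖a - t • F W‖ + ‖F (Y - t • W)‖ := norm_sub_le _ _
      _ ≤ min η (t / 2 * R / (1 + K)) + K * min η (t / 2 * R / (1 + K)) :=
        add_le_add ha ((hF _).trans (by gcongr))
      _ ≤ (t - t / 2) * R := by linarith
  obtain ⟨b, -, hb⟩ := hsurj hmem
  exact ⟨b, b.2, congrArg Subtype.val hb⟩

end Perturbation

/-! ### Three-cycles of projections and the unitaries they generate -/

theorem mul_eq_self_of_star_mul_self_eq {M : Type*} [CStarAlgebra M] {w p : M}
    (hp : IsStarProjection p) (h : star w * w = p) : w * p = w := by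
  have e1 : p * p = p := hp.isIdempotentElem
  have : star (w - w * p) * (w - w * p) = 0 := by
    rw [star_sub, star_mul, hp.isSelfAdjoint.star_eq]
    have e : (star w - p * star w) * (w - w * p) = star w * w - star w * w * p - p * (star w * w)
      + p * (star w * w) * p := by noncomm_ring
    rw [e, h, e1, e1]; abel
  exact (sub_eq_zero.mp ((CStarRing.star_mul_self_eq_zero_iff _).mp this)).symm

/-- A projection `q` of a subalgebra split into three pieces of the subalgebra which are permuted
cyclically by a unitary `P` of the corner of `q`. -/
structure IsThreeCycle {M : Type*} [CStarAlgebra M] (𝒜 : StarSubalgebra ℂ M) (q P : M)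
    (e : Fin 3 → M) : Prop where
  mem : ∀ i, e i ∈ 𝒜
  mul_eq_zero : ∀ i j, i ≠ j → e i * e j = 0
  sum_eq : e 0 + e 1 + e 2 = q
  proj : IsStarProjection q
  mul_star_eq : P * star P = q
  star_mul_eq : star P * P = q
  sq : P * P = star P
  cycle : ∀ i, e i * P = P * e (i + 1)
  star_eq : ∀ i, star (e i) = e i

section Cycle

variable {M : Type*} [CStarAlgebra M]

set_option linter.unusedSimpArgs false in
-- The summands carry `e 1` to `e 0`, `e 2` to `e 1` and `e 0` to `e 2`, which closes the cycle; the
-- remaining products vanish by orthogonality.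
theorem isThreeCycle_of_partialIsometry {𝒜 : StarSubalgebra ℂ M} {e : Fin 3 → M}
    (he : ∀ i, IsStarProjection (e i)) (hmem : ∀ i, e i ∈ 𝒜)
    (hz : ∀ i j, i ≠ j → e i * e j = 0) {u v : M} (hu : star u * u = e 0) (hu' : u * star u = e 1)
    (hv : star v * v = e 1) (hv' : v * star v = e 2)
    (hq : IsStarProjection (e 0 + e 1 + e 2)) :
    IsThreeCycle 𝒜 (e 0 + e 1 + e 2) (star u + star v + v * u) e := by
  have part := @mul_eq_self_of_star_mul_self_eq M _
  have u0 := part (he 0) hu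
  have v1 := part (he 1) hv
  have u1' : star u * e 1 = star u := part (he 1) (by rw [star_star, hu'])
  have v2' : star v * e 2 = star v := part (he 2) (by rw [star_star, hv'])
  have st : ∀ i, star (e i) = e i := fun i => (he i).isSelfAdjoint.star_eq
  have u0' : e 0 * star u = star u := by simpa [st] using congrArg star u0
  have v1' : e 1 * star v = star v := by simpa [st] using congrArg star v1
  have u1 : e 1 * u = u := by simpa [st] using congrArg star u1'
  have v2 : e 2 * v = v := by simpa [st] using congrArg star v2'
  have zero : ∀ {a b : M} {i j : Fin 3}, i ≠ j → a * e i = a → e j * b = b → a * b = 0 :=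
    fun {a b i j} hij ha hb => by
      rw [← ha, ← hb, mul_assoc, ← mul_assoc (e i), hz i j hij, zero_mul, mul_zero]
  have pre : ∀ {a : M} {i j : Fin 3}, i ≠ j → e j * a = a → e i * a = 0 := fun {a i j} hij ha => by
    rw [← ha, ← mul_assoc, hz i j hij, zero_mul]
  have post : ∀ {a : M} {i j : Fin 3}, i ≠ j → a * e i = a → a * e j = 0 := fun {a i j} hij ha => by
    rw [← ha, mul_assoc, hz i j hij, mul_zero]
  have n01 : (0 : Fin 3) ≠ 1 := by decide
  have n02 : (0 : Fin 3) ≠ 2 := by decide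
  have n12 : (1 : Fin 3) ≠ 2 := by decide
  have a1 : u * u = 0 := zero n01 u0 u1
  have a2 : u * v = 0 := zero n02 u0 v2
  have a3 : u * star v = 0 := zero n01 u0 v1'
  have a4 : v * v = 0 := zero n12 v1 v2
  have a5 : v * star u = 0 := zero n01.symm v1 u0'
  have a6 : star u * star u = 0 := zero n01.symm u1' u0'
  have a7 : star u * v = 0 := zero n12 u1' v2
  have a8 : star v * u = 0 := zero n12.symm v2' u1
  have a9 : star v * star u = 0 := zero n02.symm v2' u0'
  have a10 : star v * star v = 0 := zero n12.symm v2' v1'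
  have b1 : ∀ z, u * (u * z) = 0 := fun z => by rw [← mul_assoc, a1, zero_mul]
  have b2 : ∀ z, u * (v * z) = 0 := fun z => by rw [← mul_assoc, a2, zero_mul]
  have b4 : ∀ z, v * (v * z) = 0 := fun z => by rw [← mul_assoc, a4, zero_mul]
  have b6 : ∀ z, star u * (star u * z) = 0 := fun z => by rw [← mul_assoc, a6, zero_mul]
  have b7 : ∀ z, star u * (v * z) = 0 := fun z => by rw [← mul_assoc, a7, zero_mul]
  have b9 : ∀ z, star v * (star u * z) = 0 := fun z => by rw [← mul_assoc, a9, zero_mul]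
  have c1 : star v * (v * u) = u := by rw [← mul_assoc, hv, u1]
  have c3 : v * (u * (star u * star v)) = e 2 := by rw [← mul_assoc u, hu', v1', hv']
  have c4 : star u * (star v * (v * u)) = e 0 := by rw [c1, hu]
  refine ⟨hmem, hz, rfl, hq, ?_, ?_, ?_, ?_, st⟩
  · simp only [star_add, star_star, star_mul, mul_add, add_mul, mul_assoc, a1, a2, a3, a4, a5, a6, a7,
      a8, a9, a10, b1, b2, b4, b6, b7, b9, c1, v1, c3, c4, hu, hv, hu', hv', mul_zero, add_zero, zero_add]
  · simp only [star_add, star_star, star_mul, mul_add, add_mul, mul_assoc, a1, a2, a3, a4, a5, a6, a7,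
      a8, a9, a10, b1, b2, b4, b6, b7, b9, c1, v1, c3, c4, hu, hv, hu', hv', mul_zero, add_zero, zero_add]
    abel
  · simp only [star_add, star_star, star_mul, mul_add, add_mul, mul_assoc, a1, a2, a3, a4, a5, a6, a7,
      a8, a9, a10, b1, b2, b4, b6, b7, b9, c1, v1, c3, c4, hu, hv, hu', hv', mul_zero, add_zero, zero_add]
    abel
  · intro i
    fin_cases i
    · change e 0 * (star u + star v + v * u) = (star u + star v + v * u) * e 1
      rw [mul_add, mul_add, add_mul, add_mul, u0', u1', pre n01 v1', post n12.symm v2', ← mul_assoc,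
        pre n02 v2, mul_assoc, post n01 u0]
      simp
    · change e 1 * (star u + star v + v * u) = (star u + star v + v * u) * e 2
      rw [mul_add, mul_add, add_mul, add_mul, pre n01.symm u0', post n12 u1', v1', v2', ← mul_assoc,
        pre n12 v2, mul_assoc, post n02 u0]
      simp
    · change e 2 * (star u + star v + v * u) = (star u + star v + v * u) * e 0
      rw [mul_add, mul_add, add_mul, add_mul, pre n02.symm u0', post n01.symm u1', pre n12.symm v1',
        post n02.symm v2', ← mul_assoc, v2, mul_assoc, u0]

/-- Coefficients of the rotations about the axis `(1, 1, 1)`. -/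
theorem exists_rotation_coefficients {r : ℝ} (h0 : 0 ≤ r) (h1 : r < 1) :
    ∃ β γ : ℝ, r ^ 2 + β ^ 2 + γ ^ 2 = 1 ∧ r * β + β * γ + γ * r = 0 ∧ γ ^ 2 - β ^ 2 ≠ 0 := by
  -- Both equations follow from β + γ = 1 - r and βγ = -r(1 - r). This is the discriminant of the
  -- corresponding quadratic; as it is positive and 1 - r ≠ 0, the squares of the roots differ.
  have hD : 0 < (1 - r) * (1 + 3 * r) := by apply mul_pos <;> linarith
  have hs := Real.mul_self_sqrt hD.le
  have hs0 := Real.sqrt_pos.mpr hD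
  set s := Real.sqrt ((1 - r) * (1 + 3 * r))
  refine ⟨((1 - r) + s) / 2, ((1 - r) - s) / 2, by nlinarith, by nlinarith, ?_⟩
  have : (((1 - r) - s) / 2) ^ 2 - (((1 - r) + s) / 2) ^ 2 = -((1 - r) * s) := by ring
  rw [this]
  have : 0 < (1 - r) * s := mul_pos (by linarith) hs0
  linarith

namespace IsThreeCycle

variable {𝒜 : StarSubalgebra ℂ M} {q P : M} {e : Fin 3 → M}

theorem corner_mul (h : IsThreeCycle 𝒜 q P e) : q * P = P ∧ P * q = P := by
  refine ⟨?_, mul_eq_self_of_star_mul_self_eq h.proj h.star_mul_eq⟩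
  have h1 : star P * q = star P :=
    mul_eq_self_of_star_mul_self_eq h.proj (by rw [star_star, h.mul_star_eq])
  have h2 := congrArg star h1
  rwa [star_mul, h.proj.isSelfAdjoint.star_eq, star_star] at h2

theorem corner_star (h : IsThreeCycle 𝒜 q P e) : q * star P = star P ∧ star P * q = star P := by
  have h1 := congrArg star h.corner_mul.1
  have h2 := congrArg star h.corner_mul.2
  rw [star_mul, h.proj.isSelfAdjoint.star_eq] at h1 h2
  exact ⟨h2, h1⟩

theorem star_sq (h : IsThreeCycle 𝒜 q P e) : star P * star P = P := by
  have := congrArg star h.sq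
  rwa [star_mul, star_star] at this

theorem cycle_star (h : IsThreeCycle 𝒜 q P e) (i : Fin 3) : e i * star P = star P * e (i - 1) := by
  have := congrArg star (h.cycle (i - 1))
  rw [star_mul, star_mul, h.star_eq, h.star_eq, sub_add_cancel] at this
  exact this.symm

theorem q_mem (h : IsThreeCycle 𝒜 q P e) : q ∈ 𝒜 := by
  rw [← h.sum_eq]
  exact add_mem (add_mem (h.mem 0) (h.mem 1)) (h.mem 2)

theorem norm_le_one (h : IsThreeCycle 𝒜 q P e) : ‖P‖ ≤ 1 := by
  have h1 := CStarRing.norm_star_mul_self (x := P)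
  rw [h.star_mul_eq] at h1
  have := h.proj.norm_le
  nlinarith [norm_nonneg P]

/-- The rotation with coefficients `r`, `β`, `γ`. -/
def rotation (q P : M) (r β γ : ℝ) : M := r • q + β • P + γ • star P

theorem star_mul_rotation (h : IsThreeCycle 𝒜 q P e) {r β γ : ℝ} (h1 : r ^ 2 + β ^ 2 + γ ^ 2 = 1)
    (h2 : r * β + β * γ + γ * r = 0) : star (rotation q P r β γ) * rotation q P r β γ = q := by
  have hqs : star q = q := h.proj.isSelfAdjoint.star_eq
  have hqq : q * q = q := h.proj.isIdempotentElem
  simp only [rotation, star_add, star_smul, star_trivial, star_star, hqs, add_mul, mul_add,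
    smul_mul_assoc, mul_smul_comm, hqq, h.corner_mul.1, h.corner_mul.2, h.corner_star.1,
    h.corner_star.2, h.sq, h.star_sq, h.mul_star_eq, h.star_mul_eq]
  match_scalars <;> first | linear_combination h1 | linear_combination h2

theorem mul_star_rotation (h : IsThreeCycle 𝒜 q P e) {r β γ : ℝ} (h1 : r ^ 2 + β ^ 2 + γ ^ 2 = 1)
    (h2 : r * β + β * γ + γ * r = 0) : rotation q P r β γ * star (rotation q P r β γ) = q := by
  have hqs : star q = q := h.proj.isSelfAdjoint.star_eq
  have hqq : q * q = q := h.proj.isIdempotentElem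
  simp only [rotation, star_add, star_smul, star_trivial, star_star, hqs, add_mul, mul_add,
    smul_mul_assoc, mul_smul_comm, hqq, h.corner_mul.1, h.corner_mul.2, h.corner_star.1,
    h.corner_star.2, h.sq, h.star_sq, h.mul_star_eq, h.star_mul_eq]
  match_scalars <;> first | linear_combination h1 | linear_combination h2

theorem corner_rotation (h : IsThreeCycle 𝒜 q P e) (r β γ : ℝ) :
    q * rotation q P r β γ = rotation q P r β γ ∧ rotation q P r β γ * q = rotation q P r β γ := by
  have hqq : q * q = q := h.proj.isIdempotentElem
  simp only [rotation, add_mul, mul_add, smul_mul_assoc, mul_smul_comm, hqq, h.corner_mul.1,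
    h.corner_mul.2, h.corner_star.1, h.corner_star.2, and_self]

/-- The skew-adjoint generator attached to `b`. -/
def generator (P : M) (z : ℝ) : M →ₗ[ℝ] M where
  toFun b := z • (b * P - star P * star b)
  map_add' a b := by rw [add_mul, star_add, mul_add]; module
  map_smul' c b := by
    rw [star_smul, star_trivial c, smul_mul_assoc, mul_smul_comm, RingHom.id_apply]; module

theorem generator_apply (z : ℝ) (b : M) : generator P z b = z • (b * P - star P * star b) := rfl

theorem generator_mem_skewAdjoint (z : ℝ) (b : M) : generator P z b ∈ skewAdjoint M := by
  rw [skewAdjoint.mem_iff, generator_apply, star_smul, star_sub, star_mul, star_mul,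
    star_star, star_star, star_trivial z, ← smul_neg, neg_sub]

theorem norm_generator_le (h : IsThreeCycle 𝒜 q P e) (z : ℝ) (b : M) :
    ‖generator P z b‖ ≤ 2 * |z| * ‖b‖ := by
  rw [generator_apply, norm_smul, Real.norm_eq_abs]
  have h1 : ‖b * P‖ ≤ ‖b‖ * 1 := (norm_mul_le _ _).trans (by gcongr; exact h.norm_le_one)
  have h2 : ‖star P * star b‖ ≤ ‖b‖ * 1 := by
    rw [← star_mul, norm_star]; exact h1
  have := norm_sub_le (b * P) (star P * star b)
  nlinarith [abs_nonneg z]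

theorem commute_generator (h : IsThreeCycle 𝒜 q P e) (z : ℝ) {b : M} (hb : q * b = b) :
    Commute q (generator P z b) := by
  have hqs : star q = q := h.proj.isSelfAdjoint.star_eq
  have hb' : star b * q = star b := by
    have := congrArg star hb
    rwa [star_mul, hqs] at this
  rw [commute_iff_eq, generator_apply, mul_smul_comm, smul_mul_assoc, mul_sub, sub_mul, ← mul_assoc,
    hb, ← mul_assoc, h.corner_star.1, mul_assoc b, h.corner_mul.2, mul_assoc, hb']

end IsThreeCycle

end Cycle

/-! ### Solving the problem in a corner where both elements are nearly scalar -/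

section Expectation

set_option linter.unusedSectionVars false

variable {M : Type*} [CStarAlgebra M] [PartialOrder M] [StarOrderedRing M]
  {𝒜 : StarSubalgebra ℂ M} {E : M →ₚ[ℂ] 𝒜}

namespace IsNormalConditionalExpectation

theorem coe_bimodule (hE : IsNormalConditionalExpectation E) {a b : M} (ha : a ∈ 𝒜) (hb : b ∈ 𝒜)
    (x : M) : (E (a * x * b) : M) = a * E x * b :=
  congrArg Subtype.val (hE.bimodule ⟨a, ha⟩ ⟨b, hb⟩ x)

theorem coe_apply (hE : IsNormalConditionalExpectation E) {a : M} (ha : a ∈ 𝒜) : (E a : M) = a :=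
  congrArg Subtype.val (hE.map_coe ⟨a, ha⟩)

end IsNormalConditionalExpectation

theorem exists_norm_expectation_le (E : M →ₚ[ℂ] 𝒜) : ∃ K > 0, ∀ x, ‖(E x : M)‖ ≤ K * ‖x‖ := by
  let E' : M →ₚ[ℂ] M := PositiveLinearMap.mk₀ (𝒜.subtype.toAlgHom.toLinearMap ∘ₗ E.toLinearMap)
    fun x hx => E.map_nonneg hx
  obtain ⟨C, hC⟩ := PositiveLinearMap.exists_norm_apply_le E'
  refine ⟨C + 1, by positivity, fun x => (hC x).trans ?_⟩
  gcongr
  simp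

/-- The expectation of the compression to the corner of `q`, as a real linear map. -/
def cornerExpectation (E : M →ₚ[ℂ] 𝒜) (q : M) : M →ₗ[ℝ] M where
  toFun x := E (q * x * q)
  map_add' x y := by rw [mul_add, add_mul, map_add]; rfl
  map_smul' c x := by
    rw [← Complex.coe_smul, mul_smul_comm, smul_mul_assoc, map_smul, RingHom.id_apply,
      ← Complex.coe_smul]
    rfl

theorem cornerExpectation_apply (q x : M) : cornerExpectation E q x = E (q * x * q) := rfl

/-- The elements of the subalgebra lying in the corner of `q`. -/
def cornerSubmodule (𝒜 : StarSubalgebra ℂ M) (q : M) : Submodule ℝ M where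
  carrier := {b | b ∈ 𝒜 ∧ q * b = b}
  add_mem' ha hb := ⟨add_mem ha.1 hb.1, by rw [mul_add, ha.2, hb.2]⟩
  zero_mem' := ⟨zero_mem _, mul_zero _⟩
  smul_mem' c b hb := ⟨by rw [← Complex.coe_smul]; exact 𝒜.smul_mem hb.1 _,
    by rw [mul_smul_comm, hb.2]⟩

theorem isClosed_cornerSubmodule (h𝒜 : IsMASA 𝒜) (q : M) :
    IsClosed (cornerSubmodule 𝒜 q : Set M) :=
  h𝒜.isClosed.inter (isClosed_eq (by fun_prop) continuous_id)

namespace IsThreeCycle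

variable {q P : M} {e : Fin 3 → M}

/-- `E x` commutes with the `e i`, so its compression to `q` is the sum of the expectations of the
diagonal blocks of `x`. -/
theorem cornerExpectation_eq_zero (h : IsThreeCycle 𝒜 q P e) (h𝒜 : IsMASA 𝒜)
    (hE : IsNormalConditionalExpectation E) {x : M} (hx : ∀ i, e i * x * e i = 0) :
    cornerExpectation E q x = 0 := by
  rw [cornerExpectation_apply, hE.coe_bimodule h.q_mem h.q_mem, ← h.sum_eq]
  have hc : ∀ i j, e i * (E x : M) * e j = e i * e j * E x := fun i j => by
    rw [mul_assoc, h𝒜.prop _ (E x).2 _ (h.mem j), mul_assoc]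
  have hd : ∀ i, e i * (E x : M) * e i = 0 := fun i => by
    rw [← hE.coe_bimodule (h.mem i) (h.mem i), hx, map_zero]; rfl
  have ho : ∀ i j, i ≠ j → e i * (E x : M) * e j = 0 := fun i j hij => by
    rw [hc, h.mul_eq_zero i j hij, zero_mul]
  simp only [add_mul, mul_add, hd, ho 0 1 (by decide), ho 0 2 (by decide), ho 1 0 (by decide),
    ho 1 2 (by decide), ho 2 0 (by decide), ho 2 1 (by decide), add_zero]

/-- The linearised problem is solved by the generators. -/
theorem cornerExpectation_generator (h : IsThreeCycle 𝒜 q P e) (h𝒜 : IsMASA 𝒜)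
    (hE : IsNormalConditionalExpectation E) {r β γ : ℝ} (hβγ : γ ^ 2 - β ^ 2 ≠ 0) {b : M}
    (hb : b ∈ cornerSubmodule 𝒜 q) :
    cornerExpectation E q (generator P (γ / (γ ^ 2 - β ^ 2)) b * rotation q P r β γ +
      rotation q P r β γ * generator P (β / (γ ^ 2 - β ^ 2)) (star b)) = b := by
  have hbs : star b ∈ 𝒜 := star_mem hb.1
  have hqb : q * b = b := hb.2
  have hbq : b * q = b := by rw [h𝒜.prop b hb.1 q h.q_mem, hqb]
  have hqs : star q = q := h.proj.isSelfAdjoint.star_eq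
  have hbsq : star b * q = star b := by simpa [hqs] using congrArg star hqb
  have hqbs : q * star b = star b := by simpa [hqs] using congrArg star hbq
  have hcycle : ∀ i z, e i * (P * z) = P * (e (i + 1) * z) := fun i z => by
    rw [← mul_assoc, h.cycle, mul_assoc]
  have hcycle' : ∀ i z, e i * (star P * z) = star P * (e (i - 1) * z) := fun i z => by
    rw [← mul_assoc, h.cycle_star, mul_assoc]
  have hcom : ∀ i, ∀ a ∈ 𝒜, ∀ z, e i * (a * z) = a * (e i * z) := fun i a ha z => by
    rw [← mul_assoc, h𝒜.prop _ (h.mem i) a ha, mul_assoc]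
  have hcom1 : ∀ i, ∀ a ∈ 𝒜, e i * a = a * e i := fun i a ha => h𝒜.prop _ (h.mem i) a ha
  have hz : ∀ i j, i ≠ j → e i * e j = 0 := h.mul_eq_zero
  have n1 : ∀ i : Fin 3, i + 1 ≠ i := by decide
  have n2 : ∀ i : Fin 3, i - 1 ≠ i := by decide
  have n3 : ∀ i : Fin 3, i + 1 + 1 ≠ i := by decide
  have n4 : ∀ i : Fin 3, i - 1 - 1 ≠ i := by decide
  have z1 : ∀ a ∈ 𝒜, cornerExpectation E q (a * P) = 0 := fun a ha =>
    h.cornerExpectation_eq_zero h𝒜 hE fun i => by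
      rw [mul_assoc, mul_assoc, hcom i a ha, hcycle, hz _ _ (n1 i)]; simp
  have z2 : ∀ a ∈ 𝒜, cornerExpectation E q (a * star P) = 0 := fun a ha =>
    h.cornerExpectation_eq_zero h𝒜 hE fun i => by
      rw [mul_assoc, mul_assoc, hcom i a ha, hcycle', hz _ _ (n2 i)]; simp
  have z3 : ∀ a ∈ 𝒜, cornerExpectation E q (star P * a) = 0 := fun a ha =>
    h.cornerExpectation_eq_zero h𝒜 hE fun i => by
      rw [mul_assoc, mul_assoc, hcycle', ← hcom1 i a ha, ← mul_assoc (e (i - 1)), hz _ _ (n2 i)]; simp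
  have z4 : ∀ a ∈ 𝒜, cornerExpectation E q (P * a) = 0 := fun a ha =>
    h.cornerExpectation_eq_zero h𝒜 hE fun i => by
      rw [mul_assoc, mul_assoc, hcycle, ← hcom1 i a ha, ← mul_assoc (e (i + 1)), hz _ _ (n1 i)]; simp
  -- Two steps along the cycle do not return to the starting piece. This is where length three is
  -- needed: for a cycle of length two these products would be diagonal.
  have z5 : ∀ a ∈ 𝒜, cornerExpectation E q (star P * a * star P) = 0 := fun a ha =>
    h.cornerExpectation_eq_zero h𝒜 hE fun i => by
      rw [mul_assoc, mul_assoc, mul_assoc, hcycle', hcom _ a ha, hcycle', hz _ _ (n4 i)]; simp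
  have z6 : ∀ a ∈ 𝒜, cornerExpectation E q (P * a * P) = 0 := fun a ha =>
    h.cornerExpectation_eq_zero h𝒜 hE fun i => by
      rw [mul_assoc, mul_assoc, mul_assoc, hcycle, hcom _ a ha, hcycle, hz _ _ (n3 i)]; simp
  have z0 : cornerExpectation E q b = b := by
    rw [cornerExpectation_apply, hqb, hbq, hE.coe_apply hb.1]
  set κ := (γ ^ 2 - β ^ 2) with hκ
  -- The scalars are chosen so that the two multiples of `star P * star b * P` cancel. That term is
  -- diagonal, and its expectation is not controlled because `P` need not normalise `𝒜`. All other
  -- terms except the multiple of `b` are off-diagonal.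
  have key : generator P (γ / κ) b * rotation q P r β γ +
      rotation q P r β γ * generator P (β / κ) (star b) =
      (γ / κ * γ - β / κ * β) • b + (γ / κ * r) • (b * P) + (γ / κ * β) • (b * star P)
      - (γ / κ * r) • (star P * star b) - (γ / κ * γ) • (star P * star b * star P)
      + (β / κ * r) • (star b * P) - (β / κ * r) • (star P * b) + (β / κ * β) • (P * star b * P)
      - (β / κ * γ) • (P * b) := by
    have k1 : star P * (star P * b) = P * b := by rw [← mul_assoc, h.star_sq]
    have k2 : P * (star P * b) = b := by rw [← mul_assoc, h.mul_star_eq, hqb]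
    simp only [generator_apply, rotation, star_star, smul_mul_assoc, mul_smul_comm, mul_add, add_mul,
      sub_mul, mul_sub, mul_assoc, h.corner_mul.2, h.sq, h.mul_star_eq, hbq,
      hbsq, k1, k2]
    have k3 : q * (star b * P) = star b * P := by rw [← mul_assoc, hqbs]
    have k4 : q * (star P * b) = star P * b := by rw [← mul_assoc, h.corner_star.1]
    rw [k3, k4]
    module
  rw [key]
  simp only [map_add, map_sub, map_smul, z0, z1 b hb.1, z2 b hb.1, z3 _ hbs, z5 _ hbs, z1 _ hbs,
    z3 b hb.1, z6 _ hbs, z4 b hb.1, smul_zero, add_zero, sub_zero]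
  have : γ / κ * γ - β / κ * β = 1 := by
    rw [hκ] at hβγ ⊢
    field_simp
  rw [this, one_smul]

theorem cornerExpectation_rotation (h : IsThreeCycle 𝒜 q P e) (h𝒜 : IsMASA 𝒜)
    (hE : IsNormalConditionalExpectation E) (r β γ : ℝ) :
    cornerExpectation E q (rotation q P r β γ) = r • q := by
  have hz : ∀ i j, i ≠ j → e i * e j = 0 := h.mul_eq_zero
  have n1 : ∀ i : Fin 3, i + 1 ≠ i := by decide
  have n2 : ∀ i : Fin 3, i - 1 ≠ i := by decide
  have z1 : cornerExpectation E q P = 0 := h.cornerExpectation_eq_zero h𝒜 hE fun i => by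
    rw [h.cycle, mul_assoc, hz _ _ (n1 i), mul_zero]
  have z2 : cornerExpectation E q (star P) = 0 := h.cornerExpectation_eq_zero h𝒜 hE fun i => by
    rw [h.cycle_star, mul_assoc, hz _ _ (n2 i), mul_zero]
  have hqq : q * q = q := h.proj.isIdempotentElem
  have z0 : cornerExpectation E q q = q := by
    rw [cornerExpectation_apply, hqq, hqq, hE.coe_apply h.q_mem]
  rw [rotation, map_add, map_add, map_smul, map_smul, map_smul, z0, z1, z2]
  simp

end IsThreeCycle

/-- If `X` is nearly `t` and `a` is nearly `l < t` on a corner split into a three-cycle, then `a` is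
the expectation of a two-sided unitary translate of `X` in the corner. -/
theorem exists_corner_unitaries (h𝒜 : IsMASA 𝒜) (hE : IsNormalConditionalExpectation E)
    {l t : ℝ} (hl : 0 ≤ l) (hlt : l < t) : ∃ δ > 0, ∀ (q P : M) (e : Fin 3 → M) (X a : M),
      IsThreeCycle 𝒜 q P e → q * X = X → ‖X - t • q‖ ≤ δ → a ∈ 𝒜 → q * a = a →
      ‖a - l • q‖ ≤ δ → ∃ U V : M, star U * U = q ∧ U * star U = q ∧ star V * V = q ∧
        V * star V = q ∧ (E (U * X * V) : M) = a := by
  have ht : 0 < t := hl.trans_lt hlt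
  -- With leading coefficient `l / t`, the expectation of `t • W` is `l • q`, the centre of the
  -- targets.
  obtain ⟨β, γ, h1, h2, h3⟩ := exists_rotation_coefficients (r := l / t) (by positivity)
    ((div_lt_one ht).mpr hlt)
  obtain ⟨K, hK, hKE⟩ := exists_norm_expectation_le E
  let z := γ / (γ ^ 2 - β ^ 2)
  let y := β / (γ ^ 2 - β ^ 2)
  obtain ⟨δ, hδ, hmain⟩ := exists_exp_mul_exp_eq (M := M) (C := 2 * |z| + 2 * |y| + 1) hK
    (by positivity) ht
  refine ⟨δ, hδ, fun q P e X a h hqX hX ha hqa hal => ?_⟩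
  let W := IsThreeCycle.rotation q P (l / t) β γ
  have hWq := h.corner_rotation (l / t) β γ
  have hWW := h.star_mul_rotation h1 h2
  have hWW' := h.mul_star_rotation h1 h2
  have hqn : ‖q‖ ≤ 1 := h.proj.norm_le
  have hqs : star q = q := h.proj.isSelfAdjoint.star_eq
  have hqq : q * q = q := h.proj.isIdempotentElem
  have hWn : ‖W‖ ≤ 1 := by
    have h1 := CStarRing.norm_star_mul_self (x := W)
    rw [hWW] at h1
    nlinarith [norm_nonneg W]
  -- The generators involve adjoints and are only real-linear, hence the inverse function argument
  -- over ℝ.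
  let starL : M →ₗ[ℝ] M := (starLinearEquiv ℝ : M ≃ₗ⋆[ℝ] M).toLinearMap
  let g : M →ₗ[ℝ] M := (IsThreeCycle.generator P y).comp starL
  have hg : ∀ b, g b = IsThreeCycle.generator P y (star b) := fun b => rfl
  obtain ⟨b, hb, hbE⟩ := hmain (cornerSubmodule 𝒜 q) (cornerExpectation E q)
    (IsThreeCycle.generator P z) g W (W * X) a (isClosed_cornerSubmodule h𝒜 q)
    (fun x => by
      refine (hKE _).trans ?_
      gcongr
      calc ‖q * x * q‖ ≤ ‖q‖ * ‖x‖ * ‖q‖ := norm_mul₃_le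
        _ ≤ 1 * ‖x‖ * 1 := by gcongr
        _ = ‖x‖ := by ring)
    (fun x => ⟨(E (q * x * q)).2, by
      rw [cornerExpectation_apply, hE.coe_bimodule h.q_mem h.q_mem, ← mul_assoc, ← mul_assoc, hqq]⟩)
    (fun b => (h.norm_generator_le z b).trans (by
      gcongr; linarith [abs_nonneg y]))
    (fun b => by
      rw [hg, ← norm_star b]
      exact (h.norm_generator_le y _).trans (by gcongr; linarith [abs_nonneg z]))
    hWn (fun b hb => h.cornerExpectation_generator h𝒜 hE h3 hb)
    (by
      have : W * X - t • W = W * (X - t • q) := by rw [mul_sub, mul_smul_comm, hWq.2]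
      rw [this]
      calc _ ≤ ‖W‖ * ‖X - t • q‖ := norm_mul_le _ _
        _ ≤ 1 * δ := by gcongr
        _ = δ := one_mul δ)
    ⟨ha, hqa⟩
    (by
      rw [h.cornerExpectation_rotation h𝒜 hE, smul_smul, mul_div_cancel₀ _ ht.ne']
      exact hal)
  let : NormedAlgebra ℚ M := .restrictScalars ℚ ℂ M
  set x := IsThreeCycle.generator P z b with hx
  have hux := NormedSpace.exp_mem_unitary_of_mem_skewAdjoint
    (IsThreeCycle.generator_mem_skewAdjoint (P := P) z b)
  have huy := NormedSpace.exp_mem_unitary_of_mem_skewAdjoint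
    (IsThreeCycle.generator_mem_skewAdjoint (P := P) y (star b))
  rw [← hg] at huy
  have hbq : b * q = b := by rw [h𝒜.prop b hb.1 q h.q_mem, hb.2]
  have hcx : q * NormedSpace.exp x = NormedSpace.exp x * q :=
    ((h.commute_generator z hb.2).exp_right).eq
  have hcy : q * NormedSpace.exp (g b) = NormedSpace.exp (g b) * q := by
    rw [hg]
    refine ((h.commute_generator y ?_).exp_right).eq
    simpa [hqs] using congrArg star hbq
  rw [Unitary.mem_iff] at hux huy
  refine ⟨NormedSpace.exp x * W, NormedSpace.exp (g b) * q, ?_, ?_, ?_, ?_, ?_⟩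
  · rw [star_mul, mul_assoc, ← mul_assoc (star (NormedSpace.exp x)), hux.1, one_mul, hWW]
  · rw [star_mul, mul_assoc, ← mul_assoc W, hWW', ← mul_assoc, ← hcx, mul_assoc, hux.2, mul_one]
  · rw [star_mul, mul_assoc, ← mul_assoc (star (NormedSpace.exp (g b))), huy.1, one_mul, hqs, hqq]
  · rw [star_mul, mul_assoc, ← mul_assoc q, hqs, hqq, ← mul_assoc, ← hcy, mul_assoc, huy.2, mul_one]
  · rw [← hbE, cornerExpectation_apply]
    congr 2
    simp only [← mul_assoc]
    rw [hcx, mul_assoc _ q W, hWq.1]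

end Expectation

/-! ### Cells and their exhaustion -/

/-- A matched pair of partial isometries `u : p → q`, `v : q → p`, with `p` commuting with `T` and
`q` in the subalgebra, which solves the problem in the corner of `q`. -/
structure IsCell {M : Type*} [CStarAlgebra M] [PartialOrder M] [StarOrderedRing M]
    {𝒜 : StarSubalgebra ℂ M} (E : M →ₚ[ℂ] 𝒜) (A T u v : M) : Prop where
  ne_zero : u ≠ 0
  mul_self : u * star u * u = u
  star_mul_eq : star v * v = u * star u
  mul_star_eq : v * star v = star u * u
  mem : u * star u ∈ 𝒜
  commute : T * (star u * u) = star u * u * T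
  expectation : (E (u * T * v) : M) = A * (u * star u)

/-- The self-adjoint elements of a subalgebra. -/
def selfAdjointElems {M : Type*} [CStarAlgebra M] (𝒜 : StarSubalgebra ℂ M) : Set M :=
  {a | a ∈ 𝒜 ∧ IsSelfAdjoint a}

/-- Commuting with the real and imaginary parts of each element is enough. This lets the trace
results for commuting self-adjoint families produce projections inside `𝒜`. -/
theorem IsMASA.mem_of_mem_commutingProj {M : Type*} [CStarAlgebra M] {𝒜 : StarSubalgebra ℂ M}
    (h𝒜 : IsMASA 𝒜) {p : M} (hp : p ∈ commutingProj (selfAdjointElems 𝒜)) : p ∈ 𝒜 := by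
  refine h𝒜.mem_of_commute hp.1.isSelfAdjoint fun a ha => ?_
  have h1 : (realPart a : M) ∈ 𝒜 := by
    rw [realPart_apply_coe, ← Complex.coe_smul]
    exact 𝒜.smul_mem (add_mem ha (star_mem ha)) _
  have h2 : (imaginaryPart a : M) ∈ 𝒜 := by
    rw [imaginaryPart_apply_coe, ← Complex.coe_smul]
    exact 𝒜.smul_mem (𝒜.smul_mem (sub_mem ha (star_mem ha)) _) _
  have h3 := hp.2 _ ⟨h1, (realPart a).2⟩
  have h4 := hp.2 _ ⟨h2, (imaginaryPart a).2⟩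
  rw [← realPart_add_I_smul_imaginaryPart a, add_mul, mul_add, h3, smul_mul_assoc, h4, mul_smul_comm]

theorem IsMASA.mem_commutingProj {M : Type*} [CStarAlgebra M] {𝒜 : StarSubalgebra ℂ M}
    (h𝒜 : IsMASA 𝒜) {p : M} (hp : IsStarProjection p) (hp' : p ∈ 𝒜) :
    p ∈ commutingProj (selfAdjointElems 𝒜) :=
  ⟨hp, fun s hs => h𝒜.prop s hs.1 p hp'⟩

theorem IsStarProjection.ne_zero_of_trace_pos {M : Type*} [CStarAlgebra M] [PartialOrder M]
    {τ : M →ₚ[ℂ] ℂ} {p : M} (h : 0 < (τ p).re) : p ≠ 0 := by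
  rintro rfl
  simp at h

namespace VonNeumannAlgebra

variable {H : Type*} [NormedAddCommGroup H] [InnerProductSpace ℂ H] [CompleteSpace H]
  {M : VonNeumannAlgebra H} {τ : M →ₚ[ℂ] ℂ} {𝒜 : StarSubalgebra ℂ M} {E : M →ₚ[ℂ] 𝒜}

/-- Three orthogonal projections of trace `r` are cut successively from `f` inside `𝒜`; having equal
trace, they are equivalent in `M`. -/
theorem IsTypeIIOneFactor.exists_threeCycle (hM : M.IsTypeIIOneFactor)
    (hτ : IsFaithfulNormalTrace τ) (h𝒜 : IsMASA 𝒜) {f : M} (hf : IsStarProjection f) (hf𝒜 : f ∈ 𝒜)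
    {r : ℝ} (hr : 0 ≤ r) (hrf : 3 * r ≤ (τ f).re) :
    ∃ (q P : M) (e : Fin 3 → M), IsThreeCycle 𝒜 q P e ∧ f * q = q ∧ (τ q).re = 3 * r := by
  have hS : ∀ s ∈ selfAdjointElems 𝒜, IsSelfAdjoint s := fun s hs => hs.2
  have hc : ∀ s ∈ selfAdjointElems 𝒜, ∀ t ∈ selfAdjointElems 𝒜, s * t = t * s := fun s hs t ht =>
    h𝒜.prop s hs.1 t ht.1
  obtain ⟨e0, h0, hfe0, ht0⟩ := hM.exists_subprojection_trace_eq hτ hS hc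
    (h𝒜.mem_commutingProj hf hf𝒜) hr (by linarith)
  have m0 := h𝒜.mem_of_mem_commutingProj h0
  have hf1 : IsStarProjection (f - e0) := h0.1.sub_of_mul hf hfe0
  obtain ⟨e1, h1, hfe1, ht1⟩ := hM.exists_subprojection_trace_eq (τ := τ) hτ hS hc
    (h𝒜.mem_commutingProj hf1 (sub_mem hf𝒜 m0)) hr
    (by rw [PositiveLinearMap.re_sub]; linarith)
  have m1 := h𝒜.mem_of_mem_commutingProj h1
  have hf2 : IsStarProjection (f - e0 - e1) := h1.1.sub_of_mul hf1 hfe1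
  obtain ⟨e2, h2, hfe2, ht2⟩ := hM.exists_subprojection_trace_eq (τ := τ) hτ hS hc
    (h𝒜.mem_commutingProj hf2 (sub_mem (sub_mem hf𝒜 m0) m1)) hr
    (by rw [PositiveLinearMap.re_sub, PositiveLinearMap.re_sub]; linarith)
  have m2 := h𝒜.mem_of_mem_commutingProj h2
  have z00 : e0 * (f - e0) = 0 := by
    rw [mul_sub, h0.1.mul_eq_symm hf hfe0, h0.1.mul_self, sub_self]
  have z01 : e0 * e1 = 0 := by rw [← hfe1, ← mul_assoc, z00, zero_mul]
  have z12 : e1 * e2 = 0 := by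
    rw [← hfe2, ← mul_assoc, mul_sub, h1.1.mul_eq_symm hf1 hfe1, h1.1.mul_self, sub_self, zero_mul]
  have z02 : e0 * e2 = 0 := by
    rw [← hfe2, ← mul_assoc, mul_sub, z00, z01, sub_self, zero_mul]
  have z10 : e1 * e0 = 0 := by rw [h𝒜.prop _ m1 _ m0, z01]
  have z21 : e2 * e1 = 0 := by rw [h𝒜.prop _ m2 _ m1, z12]
  have z20 : e2 * e0 = 0 := by rw [h𝒜.prop _ m2 _ m0, z02]
  have hfe1' : f * e1 = e1 := by
    have : f * (f - e0) = f - e0 := by rw [mul_sub, hf.mul_self, hfe0]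
    rw [← hfe1, ← mul_assoc, this]
  have hfe2' : f * e2 = e2 := by
    have : f * (f - e0 - e1) = f - e0 - e1 := by rw [mul_sub, mul_sub, hf.mul_self, hfe0, hfe1']
    rw [← hfe2, ← mul_assoc, this]
  obtain ⟨u, hu, hu'⟩ := hM.exists_partialIsometry_of_trace_eq hτ h0.1 h1.1 (by rw [ht0, ht1])
  obtain ⟨v, hv, hv'⟩ := hM.exists_partialIsometry_of_trace_eq hτ h1.1 h2.1 (by rw [ht1, ht2])
  have hq : IsStarProjection (e0 + e1 + e2) :=
    (h0.1.add h1.1 z01).add h2.1 (by rw [add_mul, z02, z12, add_zero])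
  refine ⟨e0 + e1 + e2, star u + star v + v * u, ![e0, e1, e2],
    isThreeCycle_of_partialIsometry (e := ![e0, e1, e2]) ?_ ?_ ?_ hu hu' hv hv' hq, ?_, ?_⟩
  · intro i
    fin_cases i
    exacts [h0.1, h1.1, h2.1]
  · intro i
    fin_cases i
    exacts [m0, m1, m2]
  · intro i j hij
    fin_cases i <;> fin_cases j
    exacts [absurd rfl hij, z01, z02, z10, absurd rfl hij, z12, z20, z21, absurd rfl hij]
  · rw [mul_add, mul_add, hfe0, hfe1', hfe2']
  · rw [map_add, map_add, Complex.add_re, Complex.add_re, ht0, ht1, ht2]; ring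

/-- Given nonzero projections commuting with `T` and in the subalgebra, respectively, there is a
cell below them. -/
theorem IsTypeIIOneFactor.exists_cell (hM : M.IsTypeIIOneFactor)
    (hτ : IsFaithfulNormalTrace τ) (h𝒜 : IsMASA 𝒜) (hE : IsNormalConditionalExpectation E)
    {A T : M} {c : ℝ} (hA𝒜 : A ∈ 𝒜) (hA : 0 ≤ A) (hAc : A ≤ algebraMap ℝ M c) (hc : 0 ≤ c)
    (hcT : algebraMap ℝ M c ≤ T) {p q : M} (hp : IsStarProjection p) (hq : IsStarProjection q)
    (hp0 : p ≠ 0) (hq0 : q ≠ 0) (hpT : T * p = p * T) (hq𝒜 : q ∈ 𝒜) :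
    ∃ u v, IsCell E A T u v ∧ q * u = u ∧ u * p = u := by
  have hTsa : IsSelfAdjoint T := by
    have : (0 : M) ≤ algebraMap ℝ M c := hA.trans hAc
    exact .of_nonneg (this.trans hcT)
  have hST : ∀ s ∈ ({T} : Set M), IsSelfAdjoint s := by rintro _ rfl; exact hTsa
  have hcT' : ∀ s ∈ ({T} : Set M), ∀ t ∈ ({T} : Set M), s * t = t * s := by
    rintro _ rfl _ rfl; rfl
  have hcomp : ∀ {y f : M}, IsStarProjection f → 0 ≤ y → y * f = f * y → 0 ≤ y * f := by
    intro y f hf hy h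
    have := star_left_conjugate_nonneg hy f
    rwa [hf.star_eq, ← h, mul_assoc, hf.mul_self] at this
  have hcom : ∀ x : M, algebraMap ℝ M c * x = x * algebraMap ℝ M c := Algebra.commutes c
  have hAq : A * q = q * A := h𝒜.prop A hA𝒜 q hq𝒜
  let x := (T - algebraMap ℝ M c) * p
  have hx : 0 ≤ x := hcomp hp (sub_nonneg.mpr hcT) (by rw [sub_mul, mul_sub, hpT, hcom])
  let y := (algebraMap ℝ M c - A) * q
  have hy : 0 ≤ y := hcomp hq (sub_nonneg.mpr hAc) (by rw [sub_mul, mul_sub, hAq, hcom])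
  have hyc : ‖y‖ ≤ c := by
    have h1 : ‖algebraMap ℝ M c - A‖ ≤ c := by
      rw [CStarAlgebra.norm_le_iff_le_algebraMap _ hc (sub_nonneg.mpr hAc)]
      exact sub_le_self _ hA
    calc _ ≤ ‖algebraMap ℝ M c - A‖ * ‖q‖ := norm_mul_le _ _
      _ ≤ c * 1 := by
        gcongr
        exact hq.norm_le
      _ = c := mul_one c
  -- If `x = y = 0`, then `T` is `c` on `p` and `A` is `c` on `q`, so any partial isometry between
  -- pieces of equal trace gives a cell. There is then no gap for the perturbation argument to use.
  rcases (add_nonneg (norm_nonneg x) (norm_nonneg y)).eq_or_lt with h0 | hpos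
  · have hx0 : x = 0 := norm_le_zero_iff.mp (by linarith [norm_nonneg y, norm_nonneg x])
    have hy0 : y = 0 := norm_le_zero_iff.mp (by linarith [norm_nonneg y, norm_nonneg x])
    have hr1 := hτ.re_pos hp hp0
    have hr2 := hτ.re_pos hq hq0
    obtain ⟨p', hp', hpp', htp⟩ := hM.exists_subprojection_trace_eq hτ hST hcT' (p := p)
      ⟨hp, by rintro _ rfl; exact hpT⟩ (r := min (τ p).re (τ q).re) (by positivity) (min_le_left _ _)
    obtain ⟨q', hq', hqq', htq⟩ := hM.exists_subprojection_trace_eq (τ := τ) hτ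
      (S := selfAdjointElems 𝒜) (fun s hs => hs.2) (fun s hs t ht => h𝒜.prop s hs.1 t ht.1)
      (h𝒜.mem_commutingProj hq hq𝒜) (r := min (τ p).re (τ q).re) (by positivity) (min_le_right _ _)
    obtain ⟨u, hu, hu'⟩ := hM.exists_partialIsometry_of_trace_eq hτ hp'.1 hq'.1 (by rw [htp, htq])
    have hup : u * p' = u := mul_eq_self_of_star_mul_self_eq hp'.1 hu
    have huq : q' * u = u := by
      have := mul_eq_self_of_star_mul_self_eq (w := star u) hq'.1 (by rw [star_star, hu'])
      simpa [hq'.1.isSelfAdjoint.star_eq] using congrArg star this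
    have hq'0 : q' ≠ 0 := IsStarProjection.ne_zero_of_trace_pos (τ := τ) (by rw [htq]; positivity)
    have hq'm := h𝒜.mem_of_mem_commutingProj hq'
    have hTp : T * p' = c • p' := by
      have : T * p = c • p := by
        have h := hx0
        simp only [x] at h
        rwa [sub_mul, sub_eq_zero, ← Algebra.smul_def] at h
      rw [← hpp', ← mul_assoc, this, smul_mul_assoc]
    have hAq' : A * q' = c • q' := by
      have : A * q = c • q := by
        have h := hy0
        simp only [y] at h
        rw [sub_mul, sub_eq_zero, ← Algebra.smul_def] at h
        exact h.symm
      rw [← hqq', ← mul_assoc, this, smul_mul_assoc]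
    refine ⟨u, star u, ⟨?_, by rw [hu', huq], by rw [star_star], by rw [star_star], by rwa [hu'], ?_,
      ?_⟩, by rw [← huq, ← mul_assoc, hqq'], ?_⟩
    · rintro rfl
      rw [zero_mul] at hu'
      exact hq'0 hu'.symm
    · rw [hu, hp'.2 T rfl]
    · have h1 : u * T * star u = c • q' := by
        have h2 : p' * star u = star u := by simpa [hp'.1.star_eq] using congrArg star hup
        rw [← h2, mul_assoc, ← mul_assoc T, hTp, smul_mul_assoc, h2, mul_smul_comm, hu']
      have h3 : c • q' ∈ 𝒜 := by
        rw [← Complex.coe_smul]; exact 𝒜.smul_mem hq'm _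
      rw [h1, hE.coe_apply h3, hu', hAq']
    · rw [← hup, mul_assoc, hp'.1.mul_eq_symm hp hpp']
  · have hlt : c - ‖y‖ < c + ‖x‖ := by linarith
    -- Here l = c - ‖y‖ and t = c + ‖x‖ are the values that `A` and `T` nearly take on suitable
    -- spectral projections. The tolerance depends on the corner only through them, so `f` and `g`
    -- may be chosen afterwards.
    obtain ⟨δ, hδ, hmain⟩ := exists_corner_unitaries h𝒜 hE (sub_nonneg.mpr hyc) hlt
    obtain ⟨f, hf, hf0, hpf, hfn, hfc⟩ := exists_projection_near_norm hx hp hp0 (by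
      simp only [x]
      rw [sub_mul, mul_sub, ← mul_assoc, ← hpT, mul_assoc, hp.mul_self, hcom, ← mul_assoc,
        hp.mul_self]) hδ
    obtain ⟨g, hg, hg0, hqg, hgn, hgc⟩ := exists_projection_near_norm hy hq hq0 (by
      simp only [y]
      rw [sub_mul, mul_sub, ← mul_assoc q A, ← hAq, mul_assoc, hq.mul_self, hcom, ← mul_assoc,
        hq.mul_self]) hδ
    have hfT : T * f = f * T := by
      refine hfc T ?_ hpT
      exact (((Commute.refl T).sub_right (Algebra.commute_algebraMap_right c T)).mul_right hpT).eq
    have hgm : g ∈ 𝒜 := by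
      refine h𝒜.mem_of_commute hg.isSelfAdjoint fun a ha => hgc a ?_ (h𝒜.prop a ha q hq𝒜)
      have hy𝒜 : y ∈ 𝒜 := by
        refine mul_mem (sub_mem ?_ hA𝒜) hq𝒜
        rw [IsScalarTower.algebraMap_apply ℝ ℂ M]
        exact 𝒜.algebraMap_mem _
      exact h𝒜.prop a ha y hy𝒜
    have hr1 := hτ.re_pos hf hf0
    have hr2 := hτ.re_pos hg hg0
    have hm := lt_min hr1 hr2
    -- A third of the smaller trace: the corner `q'` then has a trace that a subprojection of `f`
    -- can match.
    obtain ⟨q', P, e, h3, hgq, htq⟩ := hM.exists_threeCycle (τ := τ) hτ h𝒜 hg hgm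
      (r := min (τ f).re (τ g).re / 3) (by positivity) (by linarith [min_le_right (τ f).re (τ g).re])
    obtain ⟨p', hp', hfp, htp⟩ := hM.exists_subprojection_trace_eq hτ hST hcT' (p := f)
      ⟨hf, by rintro _ rfl; exact hfT⟩ (r := 3 * (min (τ f).re (τ g).re / 3)) (by positivity)
      (by linarith [min_le_left (τ f).re (τ g).re])
    obtain ⟨w, hw, hw'⟩ := hM.exists_partialIsometry_of_trace_eq hτ hp'.1 h3.proj (by rw [htp, htq])
    have hwp : w * p' = w := mul_eq_self_of_star_mul_self_eq hp'.1 hw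
    have hwq : q' * w = w := by
      have := mul_eq_self_of_star_mul_self_eq (w := star w) h3.proj (by rw [star_star, hw'])
      simpa [h3.proj.star_eq] using congrArg star this
    have hpw : p' * star w = star w := by simpa [hp'.1.star_eq] using congrArg star hwp
    have hq'0 : q' ≠ 0 := IsStarProjection.ne_zero_of_trace_pos (τ := τ) (by rw [htq]; positivity)
    have hwn : ‖w‖ ≤ 1 := by
      have h1 := CStarRing.norm_star_mul_self (x := w)
      rw [hw] at h1
      have := hp'.1.norm_le
      nlinarith [norm_nonneg w]
    have hTf : T * f - (c + ‖x‖) • f = x * f - ‖x‖ • f := by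
      have : x * f = T * f - c • f := by
        simp only [x]
        rw [mul_assoc, hpf, sub_mul, ← Algebra.smul_def]
      rw [this, add_smul]; abel
    have hAg : A * g - (c - ‖y‖) • g = -(y * g - ‖y‖ • g) := by
      have : y * g = c • g - A * g := by
        simp only [y]
        rw [mul_assoc, hqg, sub_mul, ← Algebra.smul_def]
      rw [this, sub_smul]; abel
    obtain ⟨U, V, hU, hU', hV, hV', hUV⟩ := hmain q' P e (w * T * star w) (A * q') h3
      (by rw [← mul_assoc, ← mul_assoc, hwq])
      (by
        have : w * T * star w - (c + ‖x‖) • q' = w * ((T * f - (c + ‖x‖) • f) * (p' * star w)) := by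
          rw [sub_mul, smul_mul_assoc, mul_assoc T, ← mul_assoc f, hfp, hpw, mul_sub, mul_smul_comm,
            hw', mul_assoc]
        rw [this, hTf]
        calc _ ≤ ‖w‖ * (‖x * f - ‖x‖ • f‖ * (‖p'‖ * ‖star w‖)) := by
              refine (norm_mul_le _ _).trans ?_
              gcongr
              refine (norm_mul_le _ _).trans ?_
              gcongr
              exact norm_mul_le _ _
          _ ≤ 1 * (δ * (1 * 1)) := by
              have h1 := hp'.1.norm_le
              have h2 : ‖star w‖ ≤ 1 := by rwa [norm_star]
              gcongr
          _ = δ := by ring)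
      (mul_mem hA𝒜 h3.q_mem)
      (by rw [h𝒜.prop _ h3.q_mem _ (mul_mem hA𝒜 h3.q_mem), mul_assoc, h3.proj.mul_self])
      (by
        have : A * q' - (c - ‖y‖) • q' = (A * g - (c - ‖y‖) • g) * q' := by
          rw [sub_mul, smul_mul_assoc, mul_assoc, hgq]
        rw [this, hAg]
        calc _ ≤ ‖-(y * g - ‖y‖ • g)‖ * ‖q'‖ := norm_mul_le _ _
          _ ≤ δ * 1 := by
            rw [norm_neg]
            have h1 := h3.proj.norm_le
            gcongr
          _ = δ := mul_one δ)
    have hUq : U * q' = U := mul_eq_self_of_star_mul_self_eq h3.proj hU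
    have hqU : q' * U = U := by
      have := mul_eq_self_of_star_mul_self_eq (w := star U) h3.proj (by rw [star_star, hU'])
      simpa [h3.proj.star_eq] using congrArg star this
    have hqV : q' * V = V := by
      have := mul_eq_self_of_star_mul_self_eq (w := star V) h3.proj (by rw [star_star, hV'])
      simpa [h3.proj.star_eq] using congrArg star this
    have huu : U * w * star (U * w) = q' := by
      rw [star_mul, mul_assoc, ← mul_assoc w, hw', ← mul_assoc, hUq, hU']
    have huu' : star (U * w) * (U * w) = p' := by
      rw [star_mul, mul_assoc, ← mul_assoc (star U), hU, hwq, hw]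
    have hpf' : p * p' = p' := by rw [← hfp, ← mul_assoc, hpf]
    refine ⟨U * w, star w * V, ⟨?_, ?_, ?_, ?_, ?_, ?_, ?_⟩, ?_, ?_⟩
    · intro h
      rw [h, zero_mul] at huu
      exact hq'0 huu.symm
    · rw [huu, ← mul_assoc, hqU]
    · rw [huu, star_mul, star_star, mul_assoc, ← mul_assoc w, hw', hqV, hV]
    · rw [huu', star_mul, star_star, mul_assoc, ← mul_assoc V, hV', hwq, hw]
    · rw [huu]; exact h3.q_mem
    · rw [huu', hp'.2 T rfl]
    · rw [huu, ← hUV]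
      simp only [mul_assoc]
    · rw [← mul_assoc, ← hqU, ← mul_assoc, ← hgq, ← mul_assoc, hqg]
    · rw [mul_assoc, ← hwp, mul_assoc, hp'.1.mul_eq_symm hp hpf']

/-- If `0 ≤ A ≤ c ≤ T` then `A` is the expectation of some `U * T * V` with `U`, `V` unitary. -/
theorem IsTypeIIOneFactor.exists_unitaries_of_le (hM : M.IsTypeIIOneFactor)
    (hτ : IsFaithfulNormalTrace τ) (h𝒜 : IsMASA 𝒜) (hE : IsNormalConditionalExpectation E)
    {A T : M} {c : ℝ} (hA𝒜 : A ∈ 𝒜) (hA : 0 ≤ A) (hAc : A ≤ algebraMap ℝ M c) (hc : 0 ≤ c)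
    (hcT : algebraMap ℝ M c ≤ T) :
    ∃ U ∈ unitary M, ∃ V ∈ unitary M, (E (U * T * V) : M) = A := by
  have hTsa : IsSelfAdjoint T := by
    have : (0 : M) ≤ algebraMap ℝ M c := hA.trans hAc
    exact .of_nonneg (this.trans hcT)
  -- Orthogonality is imposed only on the first components; it passes to the second ones, whose
  -- initial and final projections are those of the first interchanged.
  obtain ⟨F, hFS, hFp, hFmax⟩ := exists_maximal_pairwise {x : M × M | IsCell E A T x.1 x.2}
    (fun x y => x.1 * star y.1 = 0 ∧ star x.1 * y.1 = 0)
  let u : F → M := fun x => x.1.1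
  let v : F → M := fun x => x.1.2
  have hcell : ∀ i, IsCell E A T (u i) (v i) := fun i => hFS i.2
  have hou : ∀ i j, i ≠ j → u i * star (u j) = 0 := fun i j h =>
    (hFp i.2 j.2 fun e => h (Subtype.ext e)).1
  have hou' : ∀ i j, i ≠ j → star (u i) * u j = 0 := fun i j h =>
    (hFp i.2 j.2 fun e => h (Subtype.ext e)).2
  have hproj : ∀ i, IsStarProjection (u i * star (u i)) := fun i =>
    ⟨by change u i * star (u i) * (u i * star (u i)) = _; rw [← mul_assoc, (hcell i).mul_self],
      .mul_star_self _⟩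
  have hproj' : ∀ i, IsStarProjection (star (u i) * u i) := fun i =>
    ⟨by
      change star (u i) * u i * (star (u i) * u i) = _
      rw [mul_assoc, ← mul_assoc (u i), (hcell i).mul_self], .star_mul_self _⟩
  have hvq : ∀ i, v i * (u i * star (u i)) = v i := fun i =>
    mul_eq_self_of_star_mul_self_eq (hproj i) (hcell i).star_mul_eq
  have hvp : ∀ i, star (v i) * (star (u i) * u i) = star (v i) := fun i =>
    mul_eq_self_of_star_mul_self_eq (hproj' i) (by rw [star_star, (hcell i).mul_star_eq])
  have hvq' : ∀ i, u i * star (u i) * star (v i) = star (v i) := fun i => by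
    simpa using congrArg star (hvq i)
  have hvp' : ∀ i, star (u i) * u i * v i = v i := fun i => by
    simpa using congrArg star (hvp i)
  have hov : ∀ i j, i ≠ j → v i * star (v j) = 0 := fun i j h => by
    rw [← hvq i, ← hvq' j, mul_assoc, mul_assoc (u i), mul_assoc (u j), ← mul_assoc (star (u i)),
      hou' i j h]
    simp
  have hov' : ∀ i j, i ≠ j → star (v i) * v j = 0 := fun i j h => by
    rw [← hvp i, ← hvp' j, mul_assoc, mul_assoc (star (u i)), mul_assoc (star (u j)),
      ← mul_assoc (u i), hou i j h]
    simp
  have hvv : ∀ i, v i * star (v i) * v i = v i := fun i => by rw [(hcell i).mul_star_eq, hvp']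
  obtain ⟨U, hU, hUr, hUl, hUi, hUf, hUz, hUz'⟩ := exists_sum_partialIsometry' u
    (fun i => (hcell i).mul_self) hou hou'
  obtain ⟨V, hV, hVr, hVl, hVi, hVf, hVz, hVz'⟩ := exists_sum_partialIsometry' v hvv hov hov'
  have hP : IsStarProjection (star U * U) :=
    ⟨by change star U * U * (star U * U) = _; rw [mul_assoc, ← mul_assoc U, hU], .star_mul_self U⟩
  have hQ : IsStarProjection (U * star U) :=
    ⟨by change U * star U * (U * star U) = _; rw [← mul_assoc, hU], .mul_star_self U⟩
  by_cases hQ1 : U * star U = 1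
  · have hP1 : star U * U = 1 := by
      have := hM.finite (star U) (by rwa [star_star])
      rwa [star_star] at this
    have hVV : star V * V = 1 := by
      have h1 : (star V * V - 1) * U = 0 := hUz _ fun i => by
        have h2 : star V * V * star (v i) = star (v i) := by
          have := congrArg star (hVi i)
          rwa [star_mul, star_mul, star_star] at this
        rw [sub_mul, one_mul, ← (hcell i).mul_self, ← (hcell i).star_mul_eq, ← mul_assoc,
          ← mul_assoc, h2, sub_self]
      have h2 : (star V * V - 1) * (U * star U) = 0 := by rw [← mul_assoc, h1, zero_mul]
      rwa [hQ1, mul_one, sub_eq_zero] at h2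
    have hVV' : V * star V = 1 := hM.finite V hVV
    refine ⟨U, Unitary.mem_iff.mpr ⟨hP1, hQ1⟩, V, Unitary.mem_iff.mpr ⟨hVV, hVV'⟩, ?_⟩
    have h1 : ((E (U * T * V) : M) - A) * U = 0 := hUz _ fun i => by
      have hqU : u i * star (u i) * U = u i := by rw [mul_assoc, hUl, ← mul_assoc, (hcell i).mul_self]
      have hVq : V * (u i * star (u i)) = v i := by
        rw [← (hcell i).star_mul_eq, ← mul_assoc, hVr, hvv]
      -- Compression by a projection of `𝒜` passes inside `E` and isolates a single cell.
      have h2 : (E (U * T * V) : M) * (u i * star (u i)) = A * (u i * star (u i)) := by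
        calc (E (U * T * V) : M) * (u i * star (u i))
            = u i * star (u i) * E (U * T * V) * (u i * star (u i)) := by
              rw [h𝒜.prop _ (hcell i).mem _ (E (U * T * V)).2, mul_assoc (E (U * T * V) : M),
                (hproj i).mul_self]
          _ = E (u i * star (u i) * (U * T * V) * (u i * star (u i))) :=
              (hE.coe_bimodule (hcell i).mem (hcell i).mem _).symm
          _ = E (u i * T * v i) := by
              have : u i * star (u i) * (U * T * V) * (u i * star (u i)) =
                (u i * star (u i) * U) * T * (V * (u i * star (u i))) := by simp only [mul_assoc]
              rw [this, hqU, hVq]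
          _ = A * (u i * star (u i)) := (hcell i).expectation
      have h3 : ((E (U * T * V) : M) - A) * (u i * star (u i)) = 0 := by
        rw [sub_mul, h2, sub_self]
      calc _ = ((E (U * T * V) : M) - A) * (u i * star (u i)) * u i := by
            rw [mul_assoc ((E (U * T * V) : M) - A), (hcell i).mul_self]
        _ = 0 := by rw [h3, zero_mul]
    have h2 : ((E (U * T * V) : M) - A) * (U * star U) = 0 := by rw [← mul_assoc, h1, zero_mul]
    rwa [hQ1, mul_one, sub_eq_zero] at h2
  · exfalso
    have hP1 : star U * U ≠ 1 := fun h => hQ1 (hM.finite U h)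
    -- Commuting with `T`, and below membership in `𝒜`, pass from the projections of the cells to
    -- their sums. The complements are thus admissible for `exists_cell`, which contradicts
    -- maximality.
    have hPT : T * (star U * U) = star U * U * T := by
      have h1 : U * (T * (1 - star U * U)) = 0 := hUz' _ fun i => by
        have h2 : star (u i) * u i * (1 - star U * U) = 0 := by
          rw [mul_sub, mul_one, mul_assoc, hUi, sub_self]
        calc _ = u i * star (u i) * u i * (T * (1 - star U * U)) := by rw [(hcell i).mul_self]
          _ = u i * (star (u i) * u i * T * (1 - star U * U)) := by simp only [mul_assoc]
          _ = 0 := by rw [← (hcell i).commute, mul_assoc T, h2, mul_zero, mul_zero]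
      have h3 : star U * U * T = star U * U * T * (star U * U) := by
        have h4 : star U * (U * (T * (1 - star U * U))) = 0 := by rw [h1, mul_zero]
        rw [mul_sub, mul_sub, mul_sub, mul_one, sub_eq_zero] at h4
        simpa only [mul_assoc] using h4
      have h5 : T * (star U * U) = star U * U * T * (star U * U) := by
        simpa only [star_mul, star_star, hTsa.star_eq, mul_assoc] using congrArg star h3
      rw [h5, ← h3]
    have hQ𝒜 : U * star U ∈ 𝒜 := by
      refine h𝒜.mem_of_commute hQ.isSelfAdjoint fun a ha => ?_
      have key : ∀ b ∈ 𝒜, b * (U * star U) = U * star U * b * (U * star U) := fun b hb => by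
        have h1 : (U * star U - 1) * b * U = 0 := hUz _ fun i => by
          have h2 : b * u i = u i * star (u i) * b * u i := by
            rw [h𝒜.prop _ (hcell i).mem b hb, mul_assoc, (hcell i).mul_self]
          have h4 : (U * star U - 1) * (u i * star (u i)) = 0 := by
            rw [sub_mul, one_mul, ← mul_assoc, hUf, sub_self]
          rw [mul_assoc, h2, ← mul_assoc, ← mul_assoc, h4, zero_mul, zero_mul]
        have h3 : (U * star U - 1) * b * U * star U = 0 := by rw [h1, zero_mul]
        rw [sub_mul, one_mul, sub_mul, sub_mul, sub_eq_zero] at h3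
        rw [← mul_assoc, ← mul_assoc, h3]
      have h1 : U * star U * a = U * star U * a * (U * star U) := by
        simpa only [star_mul, star_star, mul_assoc] using
          congrArg star (key (star a) (star_mem ha))
      rw [key a ha, ← h1]
    obtain ⟨u', v', hc', hqu, hup⟩ := hM.exists_cell hτ h𝒜 hE hA𝒜 hA hAc hc hcT hP.one_sub hQ.one_sub
      (sub_ne_zero.mpr (Ne.symm hP1)) (sub_ne_zero.mpr (Ne.symm hQ1))
      (by rw [mul_sub, sub_mul, hPT, mul_one, one_mul]) (sub_mem (one_mem _) hQ𝒜)
    have hmem : (u', v') ∈ F := by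
      refine hFmax (u', v') hc' fun x hx => ?_
      have h1 : u' * star x.1 = 0 := by
        have h2 : x.1 * (star U * U) = x.1 := hUi ⟨x, hx⟩
        have h3 := congrArg star h2
        rw [star_mul, hP.star_eq] at h3
        rw [← hup, mul_assoc, sub_mul, one_mul, h3, sub_self, mul_zero]
      have h2 : star x.1 * u' = 0 := by
        have h2 : U * star U * x.1 = x.1 := hUf ⟨x, hx⟩
        have h3 := congrArg star h2
        rw [star_mul, hQ.star_eq] at h3
        rw [← hqu, ← mul_assoc, mul_sub, mul_one, h3, sub_self, zero_mul]
      exact ⟨⟨h1, by simpa using congrArg star h2⟩, by simpa using congrArg star h1, h2⟩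
    have h1 : U * star U * u' = u' := hUf ⟨_, hmem⟩
    rw [sub_mul, one_mul, h1, sub_self] at hqu
    exact hc'.ne_zero hqu.symm

end VonNeumannAlgebra

/-! ### From singular values to operator inequalities -/

section Spectral

variable {M : Type*} [CStarAlgebra M] [PartialOrder M] [StarOrderedRing M] {τ : M →ₚ[ℂ] ℂ}

open MeasureTheory

theorem IsFaithfulNormalTrace.isProbabilityMeasure (hτ : IsFaithfulNormalTrace τ) (T : M)
    (hT : IsSelfAdjoint T) : IsProbabilityMeasure (spectralDistribution τ T hT) := by
  have h := integral_spectralDistribution τ T hT (fun _ => 1) continuous_const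
  rw [cfc_const_one ℝ T, hτ.map_one] at h
  rw [isProbabilityMeasure_iff_real]
  simpa using h

/-- The spectral distribution is carried by the spectrum. -/
theorem spectralDistribution_eq_zero {T : M} (hT : IsSelfAdjoint T) {s : Set ℝ}
    (hs : MeasurableSet s) (h : Disjoint (spectrum ℝ T) s) :
    spectralDistribution τ T hT s = 0 := by
  rw [spectralDistribution, Measure.map_apply measurable_subtype_coe hs]
  have : (Subtype.val : spectrum ℝ T → ℝ) ⁻¹' s = ∅ :=
    Set.eq_empty_of_forall_notMem fun x hx => Set.disjoint_left.mp h x.2 hx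
  rw [this, measure_empty]

/-- A nonnegative continuous function vanishing almost everywhere for the spectral distribution
of a faithful trace vanishes on the spectrum. -/
theorem IsFaithfulNormalTrace.eq_zero_of_ae (hτ : IsFaithfulNormalTrace τ) {T : M}
    (hT : IsSelfAdjoint T) {f : ℝ → ℝ} (hf : Continuous f) (hf0 : ∀ x, 0 ≤ f x)
    (h : f =ᵐ[spectralDistribution τ T hT] 0) : ∀ x ∈ spectrum ℝ T, f x = 0 := by
  -- The square root writes f(T) as `star y * y`, the form to which faithfulness applies.
  let g : ℝ → ℝ := fun x => √(f x)
  have hg : Continuous g := hf.sqrt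
  have hgg : cfc f T = cfc g T * cfc g T := by
    rw [← cfc_mul g g T hg.continuousOn hg.continuousOn]
    exact cfc_congr fun x _ => (Real.mul_self_sqrt (hf0 x)).symm
  have h1 := integral_spectralDistribution τ T hT f hf
  rw [integral_congr_ae h] at h1
  have hnn : 0 ≤ cfc f T := cfc_nonneg fun x _ => hf0 x
  have h2 : τ (cfc f T) = 0 := by
    rw [PositiveLinearMap.eq_re_of_nonneg hnn, ← h1]; simp
  have h3 : cfc g T = 0 := hτ.faithful _ (by
    rw [(cfc_predicate g T : IsSelfAdjoint _).star_eq, ← hgg, h2])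
  have h4 : cfc f T = cfc (0 : ℝ → ℝ) T := by rw [hgg, h3, mul_zero, cfc_zero ℝ T]
  exact (cfc_eq_cfc_iff_eqOn (R := ℝ) (a := T) (f := f) (g := 0) (ha := hT) hf.continuousOn
    continuous_zero.continuousOn).mp h4

theorem IsFaithfulNormalTrace.le_of_measure_Ioi (hτ : IsFaithfulNormalTrace τ) {T : M}
    {hT : IsSelfAdjoint T} {t : ℝ} (h : spectralDistribution τ T hT (Set.Ioi t) = 0) :
    ∀ x ∈ spectrum ℝ T, x ≤ t := fun x hx => by
  have := hτ.eq_zero_of_ae hT (f := fun x => max (x - t) 0) (by fun_prop)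
    (fun _ => le_max_right _ _) ?_ x hx
  · simpa using this
  · have : ∀ᵐ y ∂spectralDistribution τ T hT, y ∉ Set.Ioi t := measure_eq_zero_iff_ae_notMem.mp h
    filter_upwards [this] with y hy
    simpa using hy

theorem IsFaithfulNormalTrace.ge_of_measure_Iic (hτ : IsFaithfulNormalTrace τ) {T : M}
    {hT : IsSelfAdjoint T} {t : ℝ} (h : spectralDistribution τ T hT (Set.Iic t) = 0) :
    ∀ x ∈ spectrum ℝ T, t ≤ x := fun x hx => by
  have := hτ.eq_zero_of_ae hT (f := fun x => max (t - x) 0) (by fun_prop)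
    (fun _ => le_max_right _ _) ?_ x hx
  · simpa using this
  · have : ∀ᵐ y ∂spectralDistribution τ T hT, y ∉ Set.Iic t := measure_eq_zero_iff_ae_notMem.mp h
    filter_upwards [this] with y hy
    simpa using (not_le.mp hy).le

theorem singularValueFunction_of_nonneg {S : M} (hS : 0 ≤ S) (s : ℝ) :
    singularValueFunction τ S s = eigenvalueFunction τ S (.of_nonneg hS) s := by
  unfold singularValueFunction
  congr 1
  exact CFC.abs_of_nonneg S hS

/-- With the lower bound 0 below, this makes the defining infimum a genuine one. For a tracial state
and `s ≥ 1` the set would be all of ℝ, hence the restriction to `s < 1`. -/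
theorem norm_mem_eigenvalueSet {S : M} (hS : IsSelfAdjoint S) (s : ℝ) :
    ‖S‖ ∈ {t : ℝ | spectralDistribution τ S hS (Set.Ioi t) ≤ ENNReal.ofReal s} := by
  rw [Set.mem_ofPred_eq, spectralDistribution_eq_zero hS measurableSet_Ioi]
  · exact zero_le
  · rw [Set.disjoint_left]
    intro x hx hx'
    exact absurd ((le_algebraMap_iff_spectrum_le (R := ℝ)).mp hS.le_algebraMap_norm_self x hx)
      (not_le.mpr hx')

theorem IsFaithfulNormalTrace.zero_mem_lowerBounds (hτ : IsFaithfulNormalTrace τ) {S : M}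
    (hS : 0 ≤ S) {s : ℝ} (hs : s < 1) : 0 ∈ lowerBounds
      {t : ℝ | spectralDistribution τ S (.of_nonneg hS) (Set.Ioi t) ≤ ENNReal.ofReal s} := by
  intro t ht
  by_contra! hlt
  have := hτ.isProbabilityMeasure S (.of_nonneg hS)
  have h1 : spectralDistribution τ S (.of_nonneg hS) (Set.Ioi t) = 1 := by
    rw [← Set.compl_Iic, prob_compl_eq_one_iff measurableSet_Iic]
    refine spectralDistribution_eq_zero _ measurableSet_Iic (Set.disjoint_left.mpr fun x hx hx' => ?_)
    exact absurd (spectrum_nonneg_of_nonneg hS hx) (not_le.mpr (lt_of_le_of_lt hx' hlt))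
  rw [Set.mem_ofPred_eq, h1, ENNReal.one_le_ofReal] at ht
  linarith

theorem IsFaithfulNormalTrace.singularValueFunction_nonneg (hτ : IsFaithfulNormalTrace τ) {S : M}
    (hS : 0 ≤ S) {s : ℝ} (hs : s < 1) : 0 ≤ singularValueFunction τ S s := by
  rw [singularValueFunction_of_nonneg hS]
  exact le_csInf ⟨_, norm_mem_eigenvalueSet _ s⟩ (hτ.zero_mem_lowerBounds hS hs)

theorem IsFaithfulNormalTrace.singularValueFunction_le_norm (hτ : IsFaithfulNormalTrace τ) {S : M}
    (hS : 0 ≤ S) {s : ℝ} (hs : s < 1) : singularValueFunction τ S s ≤ ‖S‖ := by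
  rw [singularValueFunction_of_nonneg hS]
  exact csInf_le ⟨0, hτ.zero_mem_lowerBounds hS hs⟩ (norm_mem_eigenvalueSet _ s)

/-- A positive operator is dominated by the supremum of its singular values. -/
theorem IsFaithfulNormalTrace.le_algebraMap_sSup (hτ : IsFaithfulNormalTrace τ) {S : M}
    (hS : 0 ≤ S) :
    S ≤ algebraMap ℝ M (sSup (singularValueFunction τ S '' Set.Ico 0 1)) := by
  refine (le_algebraMap_iff_spectrum_le (ha := .of_nonneg hS)).mpr fun x hx => ?_
  -- The value at `s = 0` already dominates the spectrum, because no mass lies above an admissible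
  -- `t`.
  refine le_csSup_of_le ⟨‖S‖, ?_⟩ ⟨0, ⟨le_rfl, one_pos⟩, rfl⟩ ?_
  · rintro _ ⟨s, hs, rfl⟩
    exact hτ.singularValueFunction_le_norm hS hs.2
  · rw [singularValueFunction_of_nonneg hS]
    refine le_csInf ⟨_, norm_mem_eigenvalueSet _ 0⟩ fun t ht => ?_
    rw [Set.mem_ofPred_eq, ENNReal.ofReal_zero] at ht
    exact hτ.le_of_measure_Ioi (le_antisymm ht zero_le) x hx

theorem IsFaithfulNormalTrace.sSup_singularValueFunction_nonneg (hτ : IsFaithfulNormalTrace τ)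
    {S : M} (hS : 0 ≤ S) : 0 ≤ sSup (singularValueFunction τ S '' Set.Ico 0 1) := by
  refine Real.sSup_nonneg ?_
  rintro _ ⟨s, hs, rfl⟩
  exact hτ.singularValueFunction_nonneg hS hs.2

/-- A positive operator dominates the infimum of its singular values. -/
theorem IsFaithfulNormalTrace.algebraMap_sInf_le (hτ : IsFaithfulNormalTrace τ) {S : M}
    (hS : 0 ≤ S) :
    algebraMap ℝ M (sInf (singularValueFunction τ S '' Set.Ico 0 1)) ≤ S := by
  refine (algebraMap_le_iff_le_spectrum (ha := .of_nonneg hS)).mpr fun x hx => ?_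
  refine le_of_forall_lt_imp_le_of_dense fun t ht => ?_
  have := hτ.isProbabilityMeasure S (.of_nonneg hS)
  refine hτ.ge_of_measure_Iic (hT := .of_nonneg hS) ?_ x hx
  rw [← prob_compl_eq_one_iff measurableSet_Iic, Set.compl_Iic]
  -- If the mass above `t` were at most some `r < 1`, the singular value at `r` would be at most
  -- `t`, below the infimum.
  refine le_antisymm prob_le_one (le_of_forall_lt fun r hr => ?_)
  have hr' : r = ENNReal.ofReal r.toReal := (ENNReal.ofReal_toReal hr.ne_top).symm
  have hr1 : r.toReal < 1 := by simpa using ENNReal.toReal_strict_mono ENNReal.one_ne_top hr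
  by_contra! hle
  rw [hr'] at hle
  have h1 : singularValueFunction τ S r.toReal ≤ t := by
    rw [singularValueFunction_of_nonneg hS]
    exact csInf_le ⟨0, hτ.zero_mem_lowerBounds hS hr1⟩ hle
  have h2 : sInf (singularValueFunction τ S '' Set.Ico 0 1) ≤ singularValueFunction τ S r.toReal := by
    refine csInf_le ⟨0, ?_⟩ ⟨_, ⟨ENNReal.toReal_nonneg, hr1⟩, rfl⟩
    rintro _ ⟨s, hs, rfl⟩
    exact hτ.singularValueFunction_nonneg hS hs.2
  linarith

end Spectral

end

theorem mainTheorem5 {H : Type*} [NormedAddCommGroup H] [InnerProductSpace ℂ H] [CompleteSpace H]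
    (M : VonNeumannAlgebra H) (hM : M.IsTypeIIOneFactor)
    (τ : M →ₚ[ℂ] ℂ) (hτ : IsFaithfulNormalTrace τ)
    (𝒜 : StarSubalgebra ℂ M) (h𝒜 : IsMASA 𝒜)
    (E : M →ₚ[ℂ] 𝒜) (hE : IsNormalConditionalExpectation E)
    (A : 𝒜) (hA : 0 ≤ (A : M)) (T : M) (hT : 0 ≤ T)
    (hAT : Submajorizes τ T (A : M))
    (hdom : sSup (singularValueFunction τ (A : M) '' Set.Ico 0 1) ≤
      sInf (singularValueFunction τ T '' Set.Ico 0 1)) :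
    ∃ U ∈ unitary M, ∃ V ∈ unitary M, E (U * T * V) = A := by
  -- The separating scalar is the supremum of the singular values of `A`.
  obtain ⟨U, hU, V, hV, h⟩ := hM.exists_unitaries_of_le hτ h𝒜 hE A.2 hA (hτ.le_algebraMap_sSup hA)
    (hτ.sSup_singularValueFunction_nonneg hA)
    ((algebraMap_mono M hdom).trans (hτ.algebraMap_sInf_le hT))
  exact ⟨U, hU, V, hV, Subtype.ext h⟩
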